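/- **Setting.** Let $q$ be a prime power, $\mathbb F_q\subset\mathbb F_{q^3}$, and let $\tau$ be a primitive element of $\mathbb F_{q^3}$. Let $\ell_\infty$ be the line $z=0$ of $\mathrm{PG}(2,q^3)$. Represent $\mathrm{PG}(6,q)$ by the $7$-dimensional $\mathbb F_q$-space $\mathbb F_{q^3}\times\mathbb F_{q^3}\times\mathbb F_q$, with hyperplane at infinity $\Sigma_\infty\cong\mathrm{PG}(5,q)$ given by $z=0$. In the Bruck–Bose representation the affine point $(\alpha,\beta,1)$ of $\mathrm{PG}(2,q^3)$ corresponds to the point $(\alpha,\beta,1)$ of $\mathrm{PG}(6,q)$, and the point $P=(\alpha,\beta,0)$ of $\ell_\infty$ corresponds to the plane $[P]=\{(\alpha x,\beta x,0):x\in\mathbb F_{q^3}\setminus\{0\}\}$ of $\Sigma_\infty$. For a set $d$ of points of $\ell_\infty$ put $[d]=\{[P]:P\in d\}$. A homography of $\mathrm{PG}(2,q^3)$ that fixes $\ell_\infty$ induces, through its action on affine points, a homography of $\mathrm{PG}(6,q)$ that fixes $\Sigma_\infty$. A *$2$-regulus* of $\Sigma_\infty$ is a set of $q+1$ mutually disjoint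 planes such that every line meeting three of them meets all of them; its *ruling lines* are the lines that meet all its planes. That a set $\mathcal R$ of planes meets a plane $\alpha$ in a line (conic) means that the points of $\alpha$ lying on some plane of $\mathcal R$ are exactly the points of a line (a non-degenerate conic of $\alpha$). An *order-$q$-subplane* $\pi$ is an image of $\mathrm{PG}(2,q)$ under $\mathrm{PGL}(3,q^3)$; it is *exterior* if it has no point on $\ell_\infty$. The *exterior splash* $\mathbb S$ of an exterior $\pi$ is the set of points of $\ell_\infty$ on the (extended) lines of $\pi$. *Covers.* Let $\mathscr B$ be the image of $\mathrm{PG}(2,q)$ under the homography with matrix $$K=\begin{pmatrix}-\tau&1&0\\-\tau^q&1&0\\ \tau\tau^q&-\tau-\tau^q&1\end{pmatrix};$$ it is exterior. The tangent cover of the splash of $\mathscr B$ (with respect to $\mathscr B$) is the set of planes $\{(kx,x^q,0):x\in\mathbb F_{q^3}\setminus\{0\}\}$, and the conic cover is the set of planes $\{(kx,x^{q^2},0):x\in\mathbb F_{q^3}\setminus\{0\}\}$, where $k$ runs over the elements of $\mathbb F_{q^3}$ with $k^{q^2+q+1}=1$. For an exterior order-$q$-subplane $\pi$, choose a homography $g$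 that fixes $\ell_\infty$ and maps $\mathscr B$ to $\pi$; the *tangent cover* $\mathbb T$ and the *conic cover* $\mathbb C$ of $\mathbb S$ with respect to $\pi$ are the images of those of $\mathscr B$ under the homography of $\mathrm{PG}(6,q)$ induced by $g$. *Sublines.* A *$\pi$-pencil-subline* is the set of points in which the lines of $\pi$ through a fixed point of $\pi$ meet $\ell_\infty$. A *special dual conic* of $\pi$ (with respect to $\ell_\infty$) is a dual conic of $\pi$ whose extension to $\mathrm{PG}(2,q^3)$ (the dual conic with the same equation) contains all lines fixed by the group of homographies in $\mathrm{PGL}(3,q^3)$ that fix both $\pi$ and $\ell_\infty$; these lines are $\ell_\infty$ and its two conjugates with respect to $\pi$. A *$\pi$-dual-conic-subline* is the set of points in which the lines of a special dual conic of $\pi$ meet $\ell_\infty$. **Theorem.** Let $\pi$ be an exterior order-$q$-subplane of $\mathrm{PG}(2,q^3)$ with exterior splash $\mathbb S$. Homographies $g$ as in the definition of the covers exist, so $\pi$ has a tangent cover and a conic cover. Let $\mathbb T$ be a tangent cover and $\mathbb C$ a conic cover of $\mathbb S$ with respect to $\pi$ (for any choice of $g$). 1. If $d$ is a $\pi$-pencil-subline,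 then $[d]$ is a $2$-regulus of $\Sigma_\infty$ consisting of planes $[P]$ with $P\in\mathbb S$. It meets each plane of $\mathbb T$ in a ruling line of $[d]$, distinct planes of $\mathbb T$ giving distinct lines, and it meets each plane of $\mathbb C$ in a non-degenerate conic. 2. If $d$ is a $\pi$-dual-conic-subline, then $[d]$ is a $2$-regulus of $\Sigma_\infty$ consisting of planes $[P]$ with $P\in\mathbb S$. It meets each plane of $\mathbb T$ in a non-degenerate conic, and it meets each plane of $\mathbb C$ in a ruling line of $[d]$, distinct planes of $\mathbb C$ giving distinct lines. -/

import Mathlib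

open scoped LinearAlgebra.Projectivization

noncomputable section

namespace BruckBose

/-! ### Projective spaces over a field: point sets, lines, planes, conics, 2-reguli -/

section Projective

variable {K V : Type*} [Field K] [AddCommGroup V] [Module K V]

/-- The set of points of the subspace of `PG(V)` given by the linear subspace `W`. -/
def pts (W : Submodule K V) : Set (ℙ K V) := {p | p.submodule ≤ W}

/-- Lines of `PG(V)` are the linear subspaces of (vector space) dimension two. -/
def IsLine (L : Submodule K V) : Prop := Module.finrank K L = 2

/-- Planes of `PG(V)` are the linear subspaces of (vector space) dimension three. -/
def IsPlane (α : Submodule K V) : Prop := Module.finrank K α = 3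

/-- Two subspaces of `PG(V)` meet if they have a point in common. -/
def Meets (U W : Submodule K V) : Prop := (pts U ∩ pts W).Nonempty

/-- The points of `α` that lie on some member of the family `R` of subspaces. -/
def meetSet (R : Set (Submodule K V)) (α : Submodule K V) : Set (ℙ K V) :=
  {p | p ∈ pts α ∧ ∃ β ∈ R, p ∈ pts β}

/-- `R` is a 2-regulus of the projective space `H` (a subspace of `PG(V)`, in the application
`H ≅ PG(5,q)`), where `K` is the field with `q` elements: `R` consists of `q + 1` mutually disjoint
planes of `H`, and every line of `H` that meets three of the planes meets all of them. -/
def IsTwoRegulus [Fintype K] (H : Submodule K V) (R : Set (Submodule K V)) : Prop :=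
  R.ncard = Fintype.card K + 1 ∧
  (∀ α ∈ R, IsPlane α ∧ α ≤ H) ∧
  (∀ α ∈ R, ∀ β ∈ R, α ≠ β → ¬ Meets α β) ∧
  (∀ L : Submodule K V, IsLine L → L ≤ H →
    ∀ α ∈ R, ∀ β ∈ R, ∀ γ ∈ R, α ≠ β → β ≠ γ → α ≠ γ →
      Meets L α → Meets L β → Meets L γ → ∀ δ ∈ R, Meets L δ)

/-- A ruling line of `R` is a line that meets every plane of `R`. -/
def IsRulingLine (R : Set (Submodule K V)) (L : Submodule K V) : Prop :=
  IsLine L ∧ ∀ α ∈ R, Meets L α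

/-- `C` is a non-degenerate conic of the plane `α`: the zero locus in `α` of a ternary quadratic
form without singular points.  (A singular point is a zero of the form at which
the polar form, hence the gradient, vanishes; over a finite field, in every characteristic, a
ternary form without rational singular points is absolutely irreducible.) -/
def IsConic (α : Submodule K V) (C : Set (ℙ K V)) : Prop :=
  IsPlane α ∧ ∃ Q : QuadraticForm K α,
    (∀ v : α, v ≠ 0 → Q v = 0 → ∃ w : α, QuadraticMap.polar Q v w ≠ 0) ∧
    C = {p | p ∈ pts α ∧ ∀ v : α, (v : V) ∈ p.submodule → Q v = 0}

/-- `R` meets each plane of the family `X` in a ruling line of `R`, and distinct planes of `X` in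
distinct lines. -/
def MeetsInDistinctRulingLines (R X : Set (Submodule K V)) : Prop :=
  (∀ α ∈ X, ∃ L : Submodule K V, IsRulingLine R L ∧ meetSet R α = pts L) ∧
  (∀ α ∈ X, ∀ β ∈ X, α ≠ β → meetSet R α ≠ meetSet R β)

/-- `R` meets each plane of the family `X` in a non-degenerate conic of that plane. -/
def MeetsInConics (R X : Set (Submodule K V)) : Prop :=
  ∀ α ∈ X, IsConic α (meetSet R α)

end Projective

/-! ### The projective plane over the cubic extension `E`, subplanes of order `q`

`E / F` will be the cubic extension of finite fields with `q = #F` and `q ^ 3 = #E`.  The points of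
`PG(2,q^3)` have homogeneous coordinates `(x, y, z) = (v 0, v 1, v 2)`. -/

section Plane

variable (F : Type*) {E : Type*} [Field F] [Field E] [Algebra F E]

/-- The line `z = 0` of `PG(2,q^3)`. -/
def lineAtInfinity (E : Type*) [Field E] : Submodule E (Fin 3 → E) :=
  LinearMap.ker (LinearMap.proj 2 : (Fin 3 → E) →ₗ[E] E)

/-- The point set of the image of `PG(2,q)` under the linear map `g`. -/
def imageOfPG2q (g : (Fin 3 → E) →ₗ[E] (Fin 3 → E)) : Set (ℙ E (Fin 3 → E)) :=
  {p | ∃ v : Fin 3 → F, v ≠ 0 ∧ p.submodule = E ∙ g (fun i => algebraMap F E (v i))}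

/-- An order-`q`-subplane of `PG(2,q^3)`: an image of `PG(2,q)` under `PGL(3,q^3)`. -/
def IsSubplane (π : Set (ℙ E (Fin 3 → E))) : Prop :=
  ∃ g : (Fin 3 → E) ≃ₗ[E] (Fin 3 → E), π = imageOfPG2q F g.toLinearMap

/-- The action of a homography on sets of points. -/
def actPoints (g : (Fin 3 → E) ≃ₗ[E] (Fin 3 → E)) (π : Set (ℙ E (Fin 3 → E))) :
    Set (ℙ E (Fin 3 → E)) :=
  Projectivization.map g.toLinearMap g.injective '' π

/-- The action of a homography on subspaces (lines) of the plane. -/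
def actLine (g : (Fin 3 → E) ≃ₗ[E] (Fin 3 → E)) (L : Submodule E (Fin 3 → E)) :
    Submodule E (Fin 3 → E) :=
  L.map g.toLinearMap

/-- `π` is exterior to the line `L`. -/
def IsExteriorTo (π : Set (ℙ E (Fin 3 → E))) (L : Submodule E (Fin 3 → E)) : Prop :=
  Disjoint π (pts L)

/-- `L` is an (extended) line of the subplane `π`: a line of `PG(2,q^3)` containing at least two
points of `π`. -/
def IsLineOf (π : Set (ℙ E (Fin 3 → E))) (L : Submodule E (Fin 3 → E)) : Prop :=
  IsLine L ∧ ∃ p ∈ π, ∃ r ∈ π, p ≠ r ∧ p ∈ pts L ∧ r ∈ pts L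

/-- The exterior splash of `π`: the points of `z = 0` that lie on an extended line of `π`. -/
def exteriorSplash (π : Set (ℙ E (Fin 3 → E))) : Set (ℙ E (Fin 3 → E)) :=
  {p | p ∈ pts (lineAtInfinity E) ∧ ∃ L, IsLineOf π L ∧ p ∈ pts L}

/-- A `π`-pencil-subline: the set of points in which the lines of `π` through a fixed point `A` of
`π` meet the line `z = 0`. -/
def IsPencilSubline (π d : Set (ℙ E (Fin 3 → E))) : Prop :=
  ∃ A ∈ π, d = {p | p ∈ pts (lineAtInfinity E) ∧ ∃ L, IsLineOf π L ∧ A ∈ pts L ∧ p ∈ pts L}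

/-- The line with dual (line) coordinates `u` in the coordinate system given by `g`: the image
under `g` of the line `u 0 * x 0 + u 1 * x 1 + u 2 * x 2 = 0`. -/
def lineWithCoords (g : (Fin 3 → E) ≃ₗ[E] (Fin 3 → E)) (u : Fin 3 → E) :
    Submodule E (Fin 3 → E) :=
  actLine g (LinearMap.ker (∑ i, u i • (LinearMap.proj i : (Fin 3 → E) →ₗ[E] E)))

variable {F}

/-- The lines of the subplane `g(PG(2,q))` whose dual coordinates satisfy `Q = 0`. -/
def dualConic (g : (Fin 3 → E) ≃ₗ[E] (Fin 3 → E)) (Q : MvPolynomial (Fin 3) F) :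
    Set (Submodule E (Fin 3 → E)) :=
  {L | ∃ u : Fin 3 → F, u ≠ 0 ∧ MvPolynomial.eval u Q = 0 ∧
    L = lineWithCoords g (fun i => algebraMap F E (u i))}

/-- The extension to `PG(2,q^3)` of `dualConic g Q`: all lines of `PG(2,q^3)` whose dual
coordinates satisfy the same equation. -/
def extendedDualConic (g : (Fin 3 → E) ≃ₗ[E] (Fin 3 → E)) (Q : MvPolynomial (Fin 3) F) :
    Set (Submodule E (Fin 3 → E)) :=
  {L | ∃ u : Fin 3 → E, u ≠ 0 ∧ MvPolynomial.aeval u Q = 0 ∧ L = lineWithCoords g u}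

/-- The fixed lines of the group `PGL(3,q^3)_{π,ℓ}` of all homographies that fix both `π` and `ℓ`.
(For `ℓ` exterior to `π` these are three lines, `ℓ` and its two conjugates with respect to `π`.) -/
def IsFixedLine (π : Set (ℙ E (Fin 3 → E))) (ℓ L : Submodule E (Fin 3 → E)) : Prop :=
  IsLine L ∧ ∀ h : (Fin 3 → E) ≃ₗ[E] (Fin 3 → E),
    actPoints h π = π → actLine h ℓ = ℓ → actLine h L = L

variable (F)

/-- `Γ` is a `(π,ℓ)`-special dual conic: a dual conic of the subplane `π` whose extension to
`PG(2,q^3)` contains the fixed lines of `PGL(3,q^3)_{π,ℓ}`. -/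
def IsSpecialDualConic (π : Set (ℙ E (Fin 3 → E))) (ℓ : Submodule E (Fin 3 → E))
    (Γ : Set (Submodule E (Fin 3 → E))) : Prop :=
  ∃ (g : (Fin 3 → E) ≃ₗ[E] (Fin 3 → E)) (Q : MvPolynomial (Fin 3) F),
    π = imageOfPG2q F g.toLinearMap ∧ Q.IsHomogeneous 2 ∧ Q ≠ 0 ∧ Γ = dualConic g Q ∧
    ∀ L, IsFixedLine π ℓ L → L ∈ extendedDualConic g Q

/-- A `π`-dual-conic-subline: the set of points in which the lines of a special dual conic of `π`
(with respect to the line `z = 0`) meet the line `z = 0`. -/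
def IsDualConicSubline (π d : Set (ℙ E (Fin 3 → E))) : Prop :=
  ∃ Γ, IsSpecialDualConic F π (lineAtInfinity E) Γ ∧
    d = {p | p ∈ pts (lineAtInfinity E) ∧ ∃ L ∈ Γ, p ∈ pts L}

end Plane

/-! ### The Bruck–Bose representation in `PG(6,q)`

`PG(6,q)` is the projective space of the seven-dimensional `F`-space `E × E × F`; a basis
`1, τ, τ²` of `E` over `F` turns `(α, β, z)` into the seven coordinates `([α], [β], z)`.  The affine
point `(α, β, 1)` of `PG(2,q^3)` corresponds to the point `(α, β, 1)` of `PG(6,q)`. -/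

section BB

variable (F : Type*) {E : Type*} [Field F] [Field E] [Algebra F E]

/-- The hyperplane at infinity `z = 0` of `PG(6,q)`, a `PG(5,q)`. -/
def hyperplaneAtInfinity (E : Type*) [Field E] [Algebra F E] : Submodule F (E × E × F) :=
  LinearMap.ker ((LinearMap.snd F E F).comp (LinearMap.snd F E (E × F)))

/-- The `F`-linear map `(x, y, z) ↦ (x, y, 0)`. -/
def toInfinity (E : Type*) [Field E] [Algebra F E] : (Fin 3 → E) →ₗ[F] E × E × F :=
  (LinearMap.proj 0).prod ((LinearMap.proj 1).prod 0)

/-- The spread element `{(α x, β x, 0) : x ∈ E}` of the regular 2-spread of the hyperplane at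
infinity that corresponds to the point `(α, β, 0)` of the line at infinity. -/
def spreadPlane (p : ℙ E (Fin 3 → E)) : Submodule F (E × E × F) :=
  (p.submodule.restrictScalars F).map (toInfinity F E)

/-- The set of spread elements that corresponds to a set `d` of points of the line at infinity. -/
def spreadSet (d : Set (ℙ E (Fin 3 → E))) : Set (Submodule F (E × E × F)) :=
  spreadPlane F '' d

/-- The linear map of `E × E × F` induced by a homography `g` of `PG(2,q^3)` that fixes the line at
infinity.  For such `g` we have `g (x, y, z) = (x', y', c z)` with a constant `c ≠ 0`,
and the induced map is `(x, y, z) ↦ (x' / c, y' / c, z)`; so on affine points it is `g` itself. -/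
def induced (g : (Fin 3 → E) ≃ₗ[E] (Fin 3 → E)) : E × E × F →ₗ[F] E × E × F where
  toFun v := ((g ![0, 0, 1] 2)⁻¹ * g ![v.1, v.2.1, algebraMap F E v.2.2] 0,
    (g ![0, 0, 1] 2)⁻¹ * g ![v.1, v.2.1, algebraMap F E v.2.2] 1, v.2.2)
  map_add' v w := by
    have h : (![(v + w).1, (v + w).2.1, algebraMap F E (v + w).2.2] : Fin 3 → E) =
        ![v.1, v.2.1, algebraMap F E v.2.2] + ![w.1, w.2.1, algebraMap F E w.2.2] := by
      ext i; fin_cases i <;> simp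
    rw [h, map_add]
    simp [mul_add]
  map_smul' c v := by
    have h : (![(c • v).1, (c • v).2.1, algebraMap F E (c • v).2.2] : Fin 3 → E) =
        algebraMap F E c • ![v.1, v.2.1, algebraMap F E v.2.2] := by
      ext i; fin_cases i <;> simp [Algebra.smul_def]
    rw [h, map_smul]
    simp [Algebra.smul_def, mul_left_comm]

variable [Fintype F]

/-- The order-`q`-subplane `σ(PG(2,q))`, where the homography `σ` has the matrix below; it is
exterior to the line at infinity. -/
def baseSubplane (τ : E) : Set (ℙ E (Fin 3 → E)) :=
  imageOfPG2q F (Matrix.mulVecLin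
    !![-τ, 1, 0;
       -τ ^ Fintype.card F, 1, 0;
       τ * τ ^ Fintype.card F, -τ - τ ^ Fintype.card F, 1])

/-- The plane `{(k x, x^q, 0) : x ∈ E}`. -/
def planeT (k : E) : Submodule F (E × E × F) :=
  LinearMap.range ((LinearMap.mulLeft F k).prod
    ((FiniteField.frobeniusAlgHom F E).toLinearMap.prod (0 : E →ₗ[F] F)))

/-- The plane `{(k x, x^(q^2), 0) : x ∈ E}`. -/
def planeC (k : E) : Submodule F (E × E × F) :=
  LinearMap.range ((LinearMap.mulLeft F k).prod
    ((FiniteField.frobeniusAlgHom F E ^ 2).toLinearMap.prod (0 : E →ₗ[F] F)))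

/-- The set of all `k` with `k^(q^2+q+1) = 1`. -/
def normOne (E : Type*) [Field E] : Set E :=
  {k | k ^ (Fintype.card F ^ 2 + Fintype.card F + 1) = 1}

/-- `X` is the tangent cover of the exterior splash of `π`, with respect to the exterior
order-`q`-subplane `π`.  For `baseSubplane` it is
the set of the planes `planeT k`, `k^(q^2+q+1) = 1`; in general it is
the image of that set under a homography that fixes the line at infinity and maps `baseSubplane`
to `π`. -/
def IsTangentCover (τ : E) (π : Set (ℙ E (Fin 3 → E))) (X : Set (Submodule F (E × E × F))) :
    Prop :=
  ∃ g : (Fin 3 → E) ≃ₗ[E] (Fin 3 → E),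
    actLine g (lineAtInfinity E) = lineAtInfinity E ∧ actPoints g (baseSubplane F τ) = π ∧
    X = (fun k => (planeT F k).map (induced F g)) '' normOne F E

/-- `X` is the conic cover of the exterior splash of `π`, with respect to the exterior
order-`q`-subplane `π`.  For `baseSubplane` it is
the set of the planes `planeC k`, `k^(q^2+q+1) = 1`; in general it is
the image of that set under a homography that fixes the line at infinity and maps `baseSubplane`
to `π`. -/
def IsConicCover (τ : E) (π : Set (ℙ E (Fin 3 → E))) (X : Set (Submodule F (E × E × F))) :
    Prop :=
  ∃ g : (Fin 3 → E) ≃ₗ[E] (Fin 3 → E),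
    actLine g (lineAtInfinity E) = lineAtInfinity E ∧ actPoints g (baseSubplane F τ) = π ∧
    X = (fun k => (planeC F k).map (induced F g)) '' normOne F E

end BB

end BruckBose

end

/-! Write σ for `x ↦ x ^ q` on E, and N, Tr for the norm and trace to F. An exterior subplane has
coordinates (a frame, `IsFrame`) in which its points are the conjugate vectors (w, σw, σ²w) and the
line at infinity is X₀ = 0 (`exists_isFrame`): the third coordinate is an F-linear function on F³
with no nonzero zero, so it identifies F³ with E. The lines of the subplane are then c X₀ + σc X₁ +
σ²c X₂ = 0, and such a line meets infinity in (0, σ²c, -σc).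

In these coordinates every object of the theorem depends on an automorphism ρ, equal to σ or σ². For
a pencil, c runs over a two-dimensional F-space; with b = σ²c the point is (0, b, -σ²b). A special
dual conic contains the three coordinate lines, so its equation has only mixed terms and reads Tr(c₀
σc σ²c) = 0. Dividing by N(c) turns this into Tr(c₀/c) = 0, and rescaling the point to (0, 1/σc,
-1/σ²c) gives (0, b, -σb) with b = 1/σc, again in a two-dimensional F-space. So both kinds of
subline give a `ruledFamily`, with ρ = σ² for pencils and ρ = σ for dual conics. The planes of the
tangent and the conic cover are the graphs y = -k ρ(x), N(k) = 1, with ρ = σ² and ρ = σ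
respectively. The theorem becomes a statement about a family and a cover belonging to equal or to
different automorphisms.

A point (x, y) lies on the family member of b iff b y = -ρ(b) x. If b₁, b₂ are independent over F, a
relation in E × E determines the multipliers m of the points (bm, -ρ(b)m); so a line through three
members has one common m and meets all members (`isTwoRegulus_ruledFamily`). On the graph of -kρ,
write k = h/ρ(h) by Hilbert 90: the condition says that x/(bh) is fixed by ρ, so the points x ∈ F·bh
fill a line (`meetsInDistinctRulingLines_ruledFamily`). On the graph of -kρ², write k = ρ(h)/h: the
condition says that b is an F-multiple of h x ρ(x), so x runs over the zeros of Tr(u h x ρ(x)), a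
nonsingular quadratic form (`meetsInConics_ruledFamily`).

The covers are defined through the base subplane and a choice of homography. They are well defined
because two frames of one subplane differ by diag(1, e, e σe) with N(e) = 1
(`IsFrame.exists_diagonal`), which only permutes the norm-one parameters k
(`IsFrame.frameCover_eq`). -/

noncomputable section

namespace BruckBose

/-! ### Points and spans in projective space -/

section ProjectiveLemmas

variable {K V : Type*} [Field K] [AddCommGroup V] [Module K V]

lemma mk_mem_pts {W : Submodule K V} {v : V} (hv : v ≠ 0) :
    Projectivization.mk K v hv ∈ pts W ↔ v ∈ W := by
  simp [pts, Projectivization.submodule_mk, Submodule.span_singleton_le_iff_mem]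

lemma meets_iff {U W : Submodule K V} : Meets U W ↔ ∃ v ≠ 0, v ∈ U ∧ v ∈ W := by
  constructor
  · rintro ⟨p, hU, hW⟩
    induction p using Projectivization.ind with
    | h v hv => exact ⟨v, hv, (mk_mem_pts hv).1 hU, (mk_mem_pts hv).1 hW⟩
  · rintro ⟨v, hv, hU, hW⟩
    exact ⟨Projectivization.mk K v hv, (mk_mem_pts hv).2 hU, (mk_mem_pts hv).2 hW⟩

lemma mk_mem_meetSet {R : Set (Submodule K V)} {α : Submodule K V} {v : V} (hv : v ≠ 0) :
    Projectivization.mk K v hv ∈ meetSet R α ↔ v ∈ α ∧ ∃ β ∈ R, v ∈ β := by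
  simp [meetSet, mk_mem_pts]

lemma exists_smul_add_smul_eq {W : Submodule K V} (hW : Module.finrank K W = 2) {v₁ v₂ v : V}
    (h₁ : v₁ ∈ W) (h₂ : v₂ ∈ W) (h0 : v₁ ≠ 0) (hne : ∀ c : K, c • v₁ ≠ v₂) (hv : v ∈ W) :
    ∃ α β : K, v = α • v₁ + β • v₂ := by
  have hli : LinearIndependent K ![v₁, v₂] := (LinearIndependent.pair_iff' h0).2 hne
  have hfd : FiniteDimensional K W := FiniteDimensional.of_finrank_pos (by omega)
  have hspan : Submodule.span K (Set.range ![v₁, v₂]) = W := by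
    apply Submodule.eq_of_le_of_finrank_eq
    · rw [Submodule.span_le]
      rintro _ ⟨i, rfl⟩
      fin_cases i <;> simpa
    · rw [finrank_span_eq_card hli, hW]; simp
  rw [← hspan] at hv
  simp only [Matrix.range_cons, Matrix.range_empty, Set.union_empty, Set.singleton_union,
    Submodule.mem_span_pair] at hv
  obtain ⟨α, β, h⟩ := hv
  exact ⟨α, β, h.symm⟩

end ProjectiveLemmas

/-- `ρ` generates the Galois group of the cyclic cubic extension `E / F`. -/
structure IsCubicGenerator {F E : Type*} [Field F] [Field E] [Algebra F E] (ρ : E →ₐ[F] E) :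
    Prop where
  cube : ∀ x, ρ (ρ (ρ x)) = x
  trace : ∀ x, algebraMap F E (Algebra.trace F E x) = x + ρ x + ρ (ρ x)
  fixed : ∀ x, ρ x = x → ∃ c, algebraMap F E c = x

/-! ### Ruled families and graph planes in an abstract copy of E × E -/

section Regulus

variable {F E V : Type*} [Field F] [Field E] [Algebra F E] [AddCommGroup V] [Module F V]

/-- The spread element `{J (b m, -ρ b m)}`. -/
def ruledPlane (J : E × E →ₗ[F] V) (ρ : E →ₐ[F] E) (b : E) : Submodule F V :=
  LinearMap.range (J ∘ₗ (LinearMap.mulLeft F b).prod (LinearMap.mulLeft F (-ρ b)))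

/-- The plane `{J (m, -k ρ m)}`. -/
def graphPlane (J : E × E →ₗ[F] V) (ρ : E →ₐ[F] E) (k : E) : Submodule F V :=
  LinearMap.range (J ∘ₗ LinearMap.id.prod (LinearMap.mulLeft F (-k) ∘ₗ ρ.toLinearMap))

/-- The spread elements `ruledPlane J ρ b`, where `b` runs over the nonzero elements of a
two-dimensional subspace of `E`. -/
def ruledFamily (J : E × E →ₗ[F] V) (ρ : E →ₐ[F] E) (u : E) : Set (Submodule F V) :=
  ruledPlane J ρ '' {b | b ≠ 0 ∧ Algebra.trace F E (u * b) = 0}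

variable {J : E × E →ₗ[F] V} {ρ : E →ₐ[F] E}

lemma mem_ruledPlane_iff_exists {b : E} {v : V} :
    v ∈ ruledPlane J ρ b ↔ ∃ m, J (b * m, -ρ b * m) = v := Iff.rfl

lemma mem_ruledPlane (hJ : Function.Injective J) {b : E} (hb : b ≠ 0) {x y : E} :
    J (x, y) ∈ ruledPlane J ρ b ↔ b * y = -(ρ b * x) := by
  simp only [mem_ruledPlane_iff_exists, hJ.eq_iff, Prod.mk.injEq]
  constructor
  · rintro ⟨m, rfl, rfl⟩; ring
  · intro h
    refine ⟨x / b, by field_simp, ?_⟩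
    field_simp
    linear_combination -h

lemma mem_graphPlane (hJ : Function.Injective J) {k x y : E} :
    J (x, y) ∈ graphPlane J ρ k ↔ y = -(k * ρ x) := by
  simp [graphPlane, hJ.eq_iff, eq_comm]

lemma ruledPlane_le (b : E) : ruledPlane J ρ b ≤ LinearMap.range J :=
  LinearMap.range_comp_le_range _ _

lemma graphPlane_le (k : E) : graphPlane J ρ k ≤ LinearMap.range J :=
  LinearMap.range_comp_le_range _ _

lemma isPlane_ruledPlane (hdeg : Module.finrank F E = 3) (hJ : Function.Injective J) {b : E}
    (hb : b ≠ 0) : IsPlane (ruledPlane J ρ b) := by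
  rw [IsPlane, ruledPlane, LinearMap.finrank_range_of_inj, hdeg]
  rw [LinearMap.coe_comp]
  refine hJ.comp fun x y h => ?_
  simpa [hb] using congrArg Prod.fst h

lemma isPlane_graphPlane (hdeg : Module.finrank F E = 3) (hJ : Function.Injective J) (k : E) :
    IsPlane (graphPlane J ρ k) := by
  rw [IsPlane, graphPlane, LinearMap.finrank_range_of_inj, hdeg]
  rw [LinearMap.coe_comp]
  refine hJ.comp fun x y h => ?_
  simpa using congrArg Prod.fst h

/-- The hypothesis says that `b' / b` is fixed by ρ, hence lies in F. This is how proportionality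
over F is detected throughout. -/
lemma IsCubicGenerator.exists_smul_eq (hρ : IsCubicGenerator ρ) {b b' : E} (hb : b ≠ 0)
    (h : b * ρ b' = b' * ρ b) : ∃ c : F, c • b = b' := by
  obtain ⟨c, hc⟩ := hρ.fixed (b' / b) (by
    have : ρ b ≠ 0 := by simpa using hb
    rw [map_div₀]
    field_simp
    linear_combination h)
  exact ⟨c, by rw [Algebra.smul_def, hc]; field_simp⟩

lemma ruledPlane_smul (hJ : Function.Injective J) {c : F} {b : E} (hcb : c • b ≠ 0) :
    ruledPlane J ρ (c • b) = ruledPlane J ρ b := by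
  have hb : b ≠ 0 := by rintro rfl; simp at hcb
  have hc : algebraMap F E c ≠ 0 := by
    intro h; rw [Algebra.smul_def, h] at hcb; simp at hcb
  ext v
  constructor
  · intro hv
    obtain ⟨⟨x, y⟩, rfl⟩ := ruledPlane_le _ hv
    rw [mem_ruledPlane hJ hcb, Algebra.smul_def, map_mul, AlgHom.commutes] at hv
    rw [mem_ruledPlane hJ hb]
    apply mul_left_cancel₀ hc
    linear_combination hv
  · intro hv
    obtain ⟨⟨x, y⟩, rfl⟩ := ruledPlane_le _ hv
    rw [mem_ruledPlane hJ hb] at hv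
    rw [mem_ruledPlane hJ hcb, Algebra.smul_def, map_mul, AlgHom.commutes]
    linear_combination algebraMap F E c * hv

lemma fst_ne_zero_of_mem_ruledPlane (hJ : Function.Injective J) {b x y : E} (hb : b ≠ 0)
    (h : J (x, y) ∈ ruledPlane J ρ b) (hv : J (x, y) ≠ 0) : x ≠ 0 := by
  rintro rfl
  rw [mem_ruledPlane hJ hb] at h
  have hy : y = 0 := by simpa [hb] using h
  exact hv (by rw [hy]; exact J.map_zero)

lemma exists_smul_of_meets (hρ : IsCubicGenerator ρ) (hJ : Function.Injective J) {b b' : E}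
    (hb : b ≠ 0) (hb' : b' ≠ 0) (h : Meets (ruledPlane J ρ b) (ruledPlane J ρ b')) :
    ∃ c : F, c • b = b' := by
  obtain ⟨v, hv0, hv, hv'⟩ := meets_iff.1 h
  obtain ⟨⟨x, y⟩, rfl⟩ := ruledPlane_le _ hv
  have hx := fst_ne_zero_of_mem_ruledPlane hJ hb hv hv0
  rw [mem_ruledPlane hJ hb] at hv
  rw [mem_ruledPlane hJ hb'] at hv'
  apply hρ.exists_smul_eq hb
  apply mul_left_cancel₀ hx
  linear_combination b * hv' - b' * hv

lemma ruledPlane_eq_iff (hρ : IsCubicGenerator ρ)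
    (hJ : Function.Injective J) {b b' : E} (hb : b ≠ 0) (hb' : b' ≠ 0) :
    ruledPlane J ρ b = ruledPlane J ρ b' ↔ ∃ c : F, c • b = b' := by
  constructor
  · intro h
    apply exists_smul_of_meets hρ hJ hb hb'
    rw [← h, meets_iff]
    refine ⟨J (b, -ρ b), ?_, ?_, ?_⟩
    · rw [Ne, ← J.map_zero, hJ.eq_iff]; simp [hb]
    all_goals rw [mem_ruledPlane hJ hb]; ring
  · rintro ⟨c, rfl⟩
    exact (ruledPlane_smul hJ hb').symm

/-- The two-dimensional subspace of `E` orthogonal to `u` with respect to the trace form. -/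
def traceOrthogonal (F : Type*) {E : Type*} [Field F] [Field E] [Algebra F E] (u : E) :
    Submodule F E :=
  LinearMap.ker (Algebra.trace F E ∘ₗ LinearMap.mulLeft F u)

lemma mem_traceOrthogonal {u b : E} :
    b ∈ traceOrthogonal F u ↔ Algebra.trace F E (u * b) = 0 := by
  simp [traceOrthogonal]

lemma finrank_traceOrthogonal [Finite F] (hdeg : Module.finrank F E = 3) {u : E} (hu : u ≠ 0) :
    Module.finrank F (traceOrthogonal F u) = 2 := by
  have hfd : FiniteDimensional F E := FiniteDimensional.of_finrank_pos (by omega)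
  have hsurj : Function.Surjective (Algebra.trace F E ∘ₗ LinearMap.mulLeft F u) := by
    intro c
    obtain ⟨x, hx⟩ := Algebra.trace_surjective F E c
    exact ⟨x / u, by simp [mul_div_cancel₀ _ hu, hx]⟩
  have h := LinearMap.finrank_range_add_finrank_ker
    (Algebra.trace F E ∘ₗ LinearMap.mulLeft F u)
  rw [LinearMap.range_eq_top.2 hsurj, finrank_top, Module.finrank_self, hdeg] at h
  rw [traceOrthogonal]
  omega

/-- Parameters give the same plane exactly when they are proportional over F, so the family is
indexed by the points of the projective line on the two-dimensional space `traceOrthogonal F u`. -/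
lemma ncard_ruledFamily [Fintype F] (hdeg : Module.finrank F E = 3) (hρ : IsCubicGenerator ρ)
    (hJ : Function.Injective J) {u : E} (hu : u ≠ 0) :
    (ruledFamily J ρ u).ncard = Fintype.card F + 1 := by
  have hcard := Projectivization.card_of_finrank_two F _ (finrank_traceOrthogonal hdeg hu)
  rw [Nat.card_eq_fintype_card (α := F)] at hcard
  have hne : ∀ p : ℙ F (traceOrthogonal F u), (p.rep : E) ≠ 0 := fun p => by
    simpa using p.rep_nonzero
  rw [← hcard, ← Set.ncard_univ, ← Set.ncard_image_of_injective Set.univ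
    (f := fun p : ℙ F (traceOrthogonal F u) => ruledPlane J ρ (p.rep : E))]
  · congr 1
    ext α
    constructor
    · rintro ⟨b, ⟨hb, hub⟩, rfl⟩
      have hb0 : (⟨b, mem_traceOrthogonal.2 hub⟩ : traceOrthogonal F u) ≠ 0 := by simpa
      refine ⟨Projectivization.mk F _ hb0, trivial, ?_⟩
      obtain ⟨c, hc⟩ := Projectivization.exists_smul_eq_mk_rep F _ hb0
      refine ((ruledPlane_eq_iff hρ hJ hb (hne _)).2 ⟨c, ?_⟩).symm
      rw [← hc]; rfl
    · rintro ⟨p, -, rfl⟩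
      exact ⟨p.rep, ⟨hne p, mem_traceOrthogonal.1 p.rep.2⟩, rfl⟩
  · intro p r h
    obtain ⟨c, hc⟩ := (ruledPlane_eq_iff hρ hJ (hne r) (hne p)).1 h.symm
    rw [← p.mk_rep, ← r.mk_rep, Projectivization.mk_eq_mk_iff']
    exact ⟨c, Subtype.ext hc⟩

/-- Let the line meet the plane of `bᵢ` in the point with multiplier `mᵢ`. Expanding both `b₃` and
the third point in terms of the first two, and comparing the two coordinates in E, shows that `m₁`
and `m₂` are defined over F relative to `m₃`. The line then contains the point with multiplier `m₃`
on every member. -/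
lemma meets_of_meets_three [Finite F] (hdeg : Module.finrank F E = 3) (hρ : IsCubicGenerator ρ)
    (hJ : Function.Injective J) {u : E} (hu : u ≠ 0) {L : Submodule F V} (hL : IsLine L)
    {b₁ b₂ b₃ b : E} (h₁ : b₁ ≠ 0) (h₂ : b₂ ≠ 0) (hb : b ≠ 0)
    (hu₁ : Algebra.trace F E (u * b₁) = 0) (hu₂ : Algebra.trace F E (u * b₂) = 0)
    (hu₃ : Algebra.trace F E (u * b₃) = 0) (hub : Algebra.trace F E (u * b) = 0)
    (h₁₂ : ∀ c : F, c • b₁ ≠ b₂) (h₁₃ : ∀ c : F, c • b₁ ≠ b₃) (h₂₃ : ∀ c : F, c • b₂ ≠ b₃)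
    (hL₁ : Meets L (ruledPlane J ρ b₁)) (hL₂ : Meets L (ruledPlane J ρ b₂))
    (hL₃ : Meets L (ruledPlane J ρ b₃)) : Meets L (ruledPlane J ρ b) := by
  obtain ⟨v₁, hv₁, hvL₁, hvb₁⟩ := meets_iff.1 hL₁
  obtain ⟨v₂, hv₂, hvL₂, hvb₂⟩ := meets_iff.1 hL₂
  obtain ⟨v₃, hv₃, hvL₃, hvb₃⟩ := meets_iff.1 hL₃
  have hW := finrank_traceOrthogonal hdeg hu
  obtain ⟨γ, δ, hγδ⟩ := exists_smul_add_smul_eq hW (mem_traceOrthogonal.2 hu₁)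
    (mem_traceOrthogonal.2 hu₂) h₁ h₁₂ (mem_traceOrthogonal.2 hu₃)
  obtain ⟨γ', δ', hγδ'⟩ := exists_smul_add_smul_eq hW (mem_traceOrthogonal.2 hu₁)
    (mem_traceOrthogonal.2 hu₂) h₁ h₁₂ (mem_traceOrthogonal.2 hub)
  obtain ⟨α, β, hαβ⟩ := exists_smul_add_smul_eq hL hvL₁ hvL₂ hv₁ (fun c hc => by
    obtain ⟨e, he⟩ := exists_smul_of_meets hρ hJ h₁ h₂ (meets_iff.2
      ⟨v₂, hv₂, hc ▸ Submodule.smul_mem _ c hvb₁, hvb₂⟩)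
    exact h₁₂ e he) hvL₃
  have hγ : γ ≠ 0 := by
    rintro rfl
    exact h₂₃ δ (by rw [hγδ]; simp)
  have hδ : δ ≠ 0 := by
    rintro rfl
    exact h₁₃ γ (by rw [hγδ]; simp)
  rw [mem_ruledPlane_iff_exists] at hvb₁ hvb₂ hvb₃
  obtain ⟨m₁, rfl⟩ := hvb₁
  obtain ⟨m₂, rfl⟩ := hvb₂
  obtain ⟨m₃, rfl⟩ := hvb₃
  have hm₃ : m₃ ≠ 0 := by rintro rfl; exact hv₃ (by simp only [mul_zero]; exact J.map_zero)
  simp only [← map_smul, ← map_add, hJ.eq_iff, Prod.smul_mk, Prod.mk_add_mk, Prod.mk.injEq] at hαβ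
  obtain ⟨hx, hy⟩ := hαβ
  rw [hγδ, Algebra.smul_def, Algebra.smul_def, Algebra.smul_def, Algebra.smul_def] at hx
  simp only [hγδ, map_add, map_smul] at hy
  simp only [Algebra.smul_def] at hy
  -- Determinant of the linear system formed by the two coordinates; Cramer's rule gives `hs` and
  -- `ht`.
  have hdet : b₁ * ρ b₂ - b₂ * ρ b₁ ≠ 0 := fun h => by
    obtain ⟨c, hc⟩ := hρ.exists_smul_eq h₁ (sub_eq_zero.1 h)
    exact h₁₂ c hc
  have hs : algebraMap F E γ * m₃ = algebraMap F E α * m₁ := by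
    apply mul_left_cancel₀ hdet
    linear_combination ρ b₂ * hx + b₂ * hy
  have ht : algebraMap F E δ * m₃ = algebraMap F E β * m₂ := by
    apply mul_left_cancel₀ hdet
    linear_combination -ρ b₁ * hx - b₁ * hy
  have hγE : algebraMap F E γ ≠ 0 := by simpa
  have hδE : algebraMap F E δ ≠ 0 := by simpa
  have hs' : m₃ = algebraMap F E (γ⁻¹ * α) * m₁ := by
    simp only [map_mul, map_inv₀]; field_simp; linear_combination hs
  have ht' : m₃ = algebraMap F E (δ⁻¹ * β) * m₂ := by
    simp only [map_mul, map_inv₀]; field_simp; linear_combination ht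
  refine meets_iff.2 ⟨J (b * m₃, -ρ b * m₃), ?_, ?_, ⟨m₃, rfl⟩⟩
  · rw [Ne, ← J.map_zero, hJ.eq_iff]; simp [hb, hm₃]
  · have : J (b * m₃, -ρ b * m₃) =
        (γ' * (γ⁻¹ * α)) • J (b₁ * m₁, -ρ b₁ * m₁) +
        (δ' * (δ⁻¹ * β)) • J (b₂ * m₂, -ρ b₂ * m₂) := by
      rw [← map_smul, ← map_smul, ← map_add, hJ.eq_iff, hγδ']
      simp only [map_add, map_smul, Prod.smul_mk, Prod.mk_add_mk, Prod.mk.injEq]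
      simp only [Algebra.smul_def, map_mul (algebraMap F E) γ', map_mul (algebraMap F E) δ']
      constructor
      · linear_combination algebraMap F E γ' * b₁ * hs' + algebraMap F E δ' * b₂ * ht'
      · linear_combination -algebraMap F E γ' * ρ b₁ * hs' - algebraMap F E δ' * ρ b₂ * ht'
    rw [this]
    exact L.add_mem (L.smul_mem _ hvL₁) (L.smul_mem _ hvL₂)

theorem isTwoRegulus_ruledFamily [Fintype F] (hdeg : Module.finrank F E = 3)
    (hρ : IsCubicGenerator ρ) (hJ : Function.Injective J) {u : E} (hu : u ≠ 0) :
    IsTwoRegulus (LinearMap.range J) (ruledFamily J ρ u) := by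
  refine ⟨ncard_ruledFamily hdeg hρ hJ hu, ?_, ?_, ?_⟩
  · rintro _ ⟨b, ⟨hb, -⟩, rfl⟩
    exact ⟨isPlane_ruledPlane hdeg hJ hb, ruledPlane_le b⟩
  · rintro _ ⟨b, ⟨hb, -⟩, rfl⟩ _ ⟨b', ⟨hb', -⟩, rfl⟩ hne hm
    exact hne ((ruledPlane_eq_iff hρ hJ hb hb').2 (exists_smul_of_meets hρ hJ hb hb' hm))
  · rintro L hL - _ ⟨b₁, ⟨h₁, hu₁⟩, rfl⟩ _ ⟨b₂, ⟨h₂, hu₂⟩, rfl⟩ _ ⟨b₃, ⟨h₃, hu₃⟩, rfl⟩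
      h₁₂ h₂₃ h₁₃ hL₁ hL₂ hL₃ _ ⟨b, ⟨hb, hub⟩, rfl⟩
    have key : ∀ {x y : E}, x ≠ 0 → y ≠ 0 → ruledPlane J ρ x ≠ ruledPlane J ρ y →
        ∀ c : F, c • x ≠ y := fun hx hy hne c hc =>
      hne ((ruledPlane_eq_iff hρ hJ hx hy).2 ⟨c, hc⟩)
    exact meets_of_meets_three hdeg hρ hJ hu hL h₁ h₂ hb hu₁ hu₂ hu₃ hub (key h₁ h₂ h₁₂)
      (key h₁ h₃ h₁₃) (key h₂ h₃ h₂₃) hL₁ hL₂ hL₃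

/-! ### Intersections with the planes of the two covers -/

lemma eq_zero_of_sum_monoidHom {n : ℕ} {χ : Fin n → E →* E} (hχ : Function.Injective χ)
    {c : Fin n → E} (h : ∀ x, ∑ i, c i * χ i x = 0) : ∀ i, c i = 0 := by
  have hli := (linearIndependent_monoidHom E E).comp χ hχ
  refine Fintype.linearIndependent_iff.1 hli c ?_
  ext x
  simpa using h x

lemma IsCubicGenerator.exists_distinct_conjugates (hdeg : Module.finrank F E = 3)
    (hρ : IsCubicGenerator ρ) : ∃ t, ρ t ≠ t ∧ ρ (ρ t) ≠ ρ t ∧ ρ (ρ t) ≠ t := by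
  have hρ1 : ∃ x, ρ x ≠ x := by
    by_contra! hall
    have hsurj : Function.Surjective (Algebra.linearMap F E) := fun x => hρ.fixed x (hall x)
    have := LinearMap.finrank_range_of_inj (f := Algebra.linearMap F E)
      (algebraMap F E).injective
    rw [LinearMap.range_eq_top.2 hsurj, finrank_top, hdeg, Module.finrank_self] at this
    omega
  obtain ⟨t, ht⟩ := hρ1
  refine ⟨t, ht, fun h => ht (ρ.toRingHom.injective h), fun h => ht ?_⟩
  have := hρ.cube t
  rwa [h] at this

/-- Dedekind's independence of characters for id, ρ and ρ², which are distinct because some `t` has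
three distinct conjugates. -/
lemma IsCubicGenerator.eq_zero_of_sum_eq_zero (hdeg : Module.finrank F E = 3)
    (hρ : IsCubicGenerator ρ) {c : Fin 3 → E}
    (h : ∀ x, c 0 * x + c 1 * ρ x + c 2 * ρ (ρ x) = 0) : ∀ i, c i = 0 := by
  obtain ⟨t, h1, h2, h3⟩ := hρ.exists_distinct_conjugates hdeg
  refine eq_zero_of_sum_monoidHom
    (χ := ![MonoidHom.id E, (ρ : E →* E), (ρ : E →* E).comp (ρ : E →* E)]) ?_ ?_
  · intro i j hij
    have := DFunLike.congr_fun hij t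
    fin_cases i <;> fin_cases j <;> first
      | rfl
      | (exfalso
         simp at this
         first
           | exact h1 this | exact h1 this.symm | exact h2 this | exact h2 this.symm
           | exact h3 this | exact h3 this.symm)
  · intro x
    simpa [Fin.sum_univ_three] using h x

/-- Hilbert's Theorem 90. -/
lemma IsCubicGenerator.exists_eq_mul_of_norm_eq_one (hdeg : Module.finrank F E = 3)
    (hρ : IsCubicGenerator ρ) {k : E} (hk : k * ρ k * ρ (ρ k) = 1) :
    ∃ h ≠ 0, k * ρ h = h := by
  by_contra! hall
  have := hρ.eq_zero_of_sum_eq_zero hdeg (c := ![1, k, k * ρ k]) (fun x => by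
    by_contra hx
    -- The Lagrange resolvent solves `k * ρ h = h`; by independence of characters it does not vanish
    -- for all `x`.
    refine hall (x + k * ρ x + k * ρ k * ρ (ρ x)) (by simpa using hx) ?_
    simp only [map_add, map_mul, hρ.cube]
    linear_combination x * hk) 0
  simp at this

/-- With `k * ρ h = h`, the plane of `b` meets the graph plane exactly in the F-multiples of the
point with first coordinate `b * h`. As `b` varies in the trace-orthogonal space these points fill a
line, which by construction meets every member. -/
theorem meetsInDistinctRulingLines_ruledFamily [Finite F] (hdeg : Module.finrank F E = 3)
    (hρ : IsCubicGenerator ρ) (hJ : Function.Injective J) {u : E} (hu : u ≠ 0) :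
    MeetsInDistinctRulingLines (ruledFamily J ρ u)
      (graphPlane J ρ '' {k | k * ρ k * ρ (ρ k) = 1}) := by
  have key : ∀ k : E, k * ρ k * ρ (ρ k) = 1 → ∃ L : Submodule F V,
      IsRulingLine (ruledFamily J ρ u) L ∧
      meetSet (ruledFamily J ρ u) (graphPlane J ρ k) = pts L := by
    intro k hk
    obtain ⟨h, h0, hkh⟩ := hρ.exists_eq_mul_of_norm_eq_one hdeg hk
    let f : E →ₗ[F] V := J ∘ₗ
      (LinearMap.mulRight F h).prod (-(LinearMap.mulRight F h ∘ₗ ρ.toLinearMap))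
    have hf : ∀ b, f b = J (b * h, -(ρ b * h)) := fun b => rfl
    have hfinj : Function.Injective f := by
      intro b b' hbb
      rw [hf, hf, hJ.eq_iff, Prod.mk.injEq] at hbb
      exact mul_right_cancel₀ h0 hbb.1
    refine ⟨(traceOrthogonal F u).map f, ⟨?_, ?_⟩, ?_⟩
    · rw [IsLine, ← finrank_traceOrthogonal hdeg hu]
      exact (Submodule.equivMapOfInjective f hfinj _).finrank_eq.symm
    · rintro _ ⟨b, ⟨hb, hub⟩, rfl⟩
      refine meets_iff.2 ⟨f b, ?_, ⟨b, mem_traceOrthogonal.2 hub, rfl⟩, ?_⟩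
      · rwa [Ne, map_eq_zero_iff f hfinj]
      · rw [hf, mem_ruledPlane hJ hb]; ring
    · ext p
      induction p using Projectivization.ind with
      | h v hv =>
        rw [mk_mem_meetSet, mk_mem_pts]
        constructor
        · rintro ⟨hP, _, ⟨b, ⟨hb, hub⟩, rfl⟩, hvb⟩
          obtain ⟨⟨x, y⟩, rfl⟩ := graphPlane_le _ hP
          have hx := fst_ne_zero_of_mem_ruledPlane hJ hb hvb hv
          rw [mem_graphPlane hJ] at hP
          rw [mem_ruledPlane hJ hb] at hvb
          obtain ⟨c, hc⟩ := hρ.exists_smul_eq (b := b * h) (b' := x) (mul_ne_zero hb h0) (by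
            rw [map_mul]
            linear_combination (-b * ρ x) * hkh - ρ h * hvb + ρ h * b * hP)
          refine ⟨c • b, Submodule.smul_mem _ c (mem_traceOrthogonal.2 hub), ?_⟩
          rw [hf, hP, hJ.eq_iff, ← hc]
          simp only [map_smul, map_mul, smul_mul_assoc, Prod.mk.injEq, true_and, mul_smul_comm]
          congr 2
          linear_combination (-ρ b) * hkh
        · rintro ⟨b, hb, rfl⟩
          have hb0 : b ≠ 0 := by rintro rfl; simp at hv
          refine ⟨?_, _, ⟨b, ⟨hb0, mem_traceOrthogonal.1 hb⟩, rfl⟩, ?_⟩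
          · rw [hf, mem_graphPlane hJ, map_mul]
            linear_combination ρ b * hkh
          · rw [hf, mem_ruledPlane hJ hb0]; ring
  constructor
  · rintro _ ⟨k, hk, rfl⟩
    exact key k hk
  -- One common nonzero point of two graph planes already forces `k = k'`, since its second
  -- coordinate is `-k * ρ x` with `x ≠ 0`.
  · rintro _ ⟨k, hk, rfl⟩ _ ⟨k', hk', rfl⟩ hne heq
    obtain ⟨L, ⟨hL, -⟩, hmeet⟩ := key k hk
    have : Nontrivial L := Module.nontrivial_of_finrank_pos (R := F) (by rw [hL]; norm_num)
    obtain ⟨⟨v, hvL⟩, hv⟩ := exists_ne (0 : L)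
    have hv0 : v ≠ 0 := by simpa using hv
    have hmem := (mk_mem_pts hv0).2 hvL
    rw [← hmeet] at hmem
    have hmem' := hmem
    rw [heq] at hmem'
    have h1 := ((mk_mem_meetSet hv0).1 hmem).1
    have h2 := ((mk_mem_meetSet hv0).1 hmem').1
    obtain ⟨⟨x, y⟩, rfl⟩ := graphPlane_le _ h1
    rw [mem_graphPlane hJ] at h1 h2
    have hx : ρ x ≠ 0 := by
      intro hx
      have hx0 : x = 0 := by simpa using hx
      exact hv0 (by rw [h1, hx0]; simp only [map_zero, mul_zero, neg_zero]; exact J.map_zero)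
    exact hne (by rw [mul_right_cancel₀ hx (show k * ρ x = k' * ρ x by linear_combination h1 - h2)])

/-- The quadratic form `x ↦ trace (g x ρ x)`. -/
def traceQuadraticForm (ρ : E →ₐ[F] E) (g : E) : QuadraticForm F E :=
  LinearMap.BilinMap.toQuadraticMap
    (((LinearMap.mul F E).compl₁₂ (LinearMap.mulLeft F g) ρ.toLinearMap).compr₂ (Algebra.trace F E))

lemma traceQuadraticForm_apply (g x : E) :
    traceQuadraticForm ρ g x = Algebra.trace F E (g * x * ρ x) := rfl

lemma polar_traceQuadraticForm (g x y : E) :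
    QuadraticMap.polar (traceQuadraticForm ρ g) x y =
      Algebra.trace F E (g * x * ρ y + g * y * ρ x) := by
  simp only [QuadraticMap.polar, traceQuadraticForm_apply, ← map_sub]
  congr 1
  simp only [map_add]
  ring

lemma exists_polar_traceQuadraticForm_ne_zero [Finite F] (hdeg : Module.finrank F E = 3)
    (hρ : IsCubicGenerator ρ) {g x : E} (hg : g ≠ 0) (hx : x ≠ 0)
    (hQ : traceQuadraticForm ρ g x = 0) :
    ∃ y, QuadraticMap.polar (traceQuadraticForm ρ g) x y ≠ 0 := by
  by_contra! hall
  -- The polar form at `x`, written in the conjugates of `y`, must have zero coefficients.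
  -- Subtracting `x` times the first coefficient from the equation of the form leaves the single
  -- product `ρ g * ρ x * ρ (ρ x)`, so the argument works in every characteristic.
  have key := hρ.eq_zero_of_sum_eq_zero hdeg
    (c := ![g * ρ x + ρ (ρ g) * ρ (ρ x), ρ g * ρ (ρ x) + g * x, ρ (ρ g) * x + ρ g * ρ x])
    (fun y => by
      have h := congrArg (algebraMap F E) (hall y)
      rw [polar_traceQuadraticForm, hρ.trace, map_zero] at h
      simp only [map_add, map_mul, hρ.cube] at h
      simp only [Matrix.cons_val]
      linear_combination h) 0
  rw [traceQuadraticForm_apply] at hQ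
  have h := congrArg (algebraMap F E) hQ
  rw [hρ.trace, map_zero] at h
  simp only [map_mul, hρ.cube] at h
  simp only [Matrix.cons_val] at key
  have : ρ g * ρ x * ρ (ρ x) = 0 := by linear_combination h - x * key
  simp [hg, hx] at this

/-- With `ρ h = k * h`, the point with first coordinate `x` of the graph of `-k ρ²` lies on the
plane of `b` iff `b` is an F-multiple of `h * x * ρ x`. Such a `b` belongs to the family iff the
trace of `u * h * x * ρ x` vanishes, a quadratic condition on `x`. -/
theorem meetsInConics_ruledFamily [Finite F] (hdeg : Module.finrank F E = 3)
    (hρ : IsCubicGenerator ρ) {ρ' : E →ₐ[F] E} (hρ' : ∀ x, ρ' x = ρ (ρ x))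
    (hJ : Function.Injective J) {u : E} (hu : u ≠ 0) :
    MeetsInConics (ruledFamily J ρ u) (graphPlane J ρ' '' {k | k * ρ k * ρ (ρ k) = 1}) := by
  rintro _ ⟨k, hk, rfl⟩
  obtain ⟨h', h0', hkh'⟩ := hρ.exists_eq_mul_of_norm_eq_one hdeg hk
  -- The inverse of the element from Hilbert 90.
  obtain ⟨h, h0, hkh⟩ : ∃ h ≠ 0, ρ h = k * h := by
    have : ρ h' ≠ 0 := by simpa
    refine ⟨h'⁻¹, inv_ne_zero h0', ?_⟩
    rw [map_inv₀]
    field_simp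
    rw [mul_comm, hkh']
  refine ⟨isPlane_graphPlane hdeg hJ k, ?_⟩
  let f : E →ₗ[F] V := J ∘ₗ LinearMap.id.prod (LinearMap.mulLeft F (-k) ∘ₗ ρ'.toLinearMap)
  have hf : ∀ x, f x = J (x, -k * ρ' x) := fun x => rfl
  have hfinj : Function.Injective f := by
    intro x y hxy
    rw [hf, hf, hJ.eq_iff, Prod.mk.injEq] at hxy
    exact hxy.1
  let e : E ≃ₗ[F] graphPlane J ρ' k := LinearEquiv.ofInjective f hfinj
  have he : ∀ x, (e x : V) = f x := fun x => rfl
  have hug : u * h ≠ 0 := mul_ne_zero hu h0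
  have hQ : ∀ x, ((traceQuadraticForm ρ (u * h)).comp e.symm.toLinearMap) (e x) =
      traceQuadraticForm ρ (u * h) x := fun x => by simp
  refine ⟨(traceQuadraticForm ρ (u * h)).comp e.symm.toLinearMap, ?_, ?_⟩
  · intro v hv hQv
    obtain ⟨x, rfl⟩ := e.surjective v
    rw [hQ] at hQv
    obtain ⟨y, hy⟩ := exists_polar_traceQuadraticForm_ne_zero hdeg hρ hug (by simpa using hv) hQv
    refine ⟨e y, ?_⟩
    rwa [QuadraticMap.polar, ← map_add, hQ, hQ, hQ]
  · ext p
    induction p using Projectivization.ind with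
    | h v hv =>
      rw [mk_mem_meetSet, Set.mem_ofPred_eq, mk_mem_pts]
      refine and_congr_right fun hP => ?_
      obtain ⟨x, rfl⟩ : ∃ x, f x = v := hP
      have hx : x ≠ 0 := by rintro rfl; simp at hv
      have hρx : ρ x ≠ 0 := by simpa
      have h2 : (∀ v : graphPlane J ρ' k, (v : V) ∈ (Projectivization.mk F (f x) hv).submodule →
          (traceQuadraticForm ρ (u * h)).comp e.symm.toLinearMap v = 0) ↔
          traceQuadraticForm ρ (u * h) x = 0 := by
        rw [Projectivization.submodule_mk]
        constructor
        · intro hall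
          rw [← hQ]
          exact hall (e x) (Submodule.mem_span_singleton_self _)
        · intro hx v hv
          obtain ⟨c, hc⟩ := Submodule.mem_span_singleton.1 hv
          have : v = e (c • x) := Subtype.ext (by rw [← hc, he, map_smul])
          rw [this, hQ, QuadraticMap.map_smul, hx, smul_zero]
      rw [h2, traceQuadraticForm_apply]
      constructor
      · rintro ⟨_, ⟨b, ⟨hb, hub⟩, rfl⟩, hvb⟩
        rw [hf, mem_ruledPlane hJ hb, hρ'] at hvb
        obtain ⟨c, hc⟩ := hρ.exists_smul_eq (b := b) (b' := h * x * ρ x) hb (by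
          simp only [map_mul, hkh]
          linear_combination (-h * ρ x) * hvb)
        have : u * h * x * ρ x = c • (u * b) := by
          rw [← mul_smul_comm, hc]; ring
        rw [this, map_smul, hub, smul_zero]
      · intro ht
        have ht0 : h * x * ρ x ≠ 0 := mul_ne_zero (mul_ne_zero h0 hx) hρx
        refine ⟨_, ⟨h * x * ρ x, ⟨ht0, ?_⟩, rfl⟩, ?_⟩
        · rw [← ht]; congr 1; ring
        · rw [hf, mem_ruledPlane hJ ht0, hρ']
          simp only [map_mul, hkh]
          ring

end Regulus

/-! ### Independence of quadratic monomials in the conjugates -/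

section GaloisQuadratic

variable {F E : Type*} [Field F] [Field E] [Algebra F E]

/-- The products of two conjugates are linearly independent functions. -/
lemma IsCubicGenerator.eq_zero_of_quadratic_eq_zero (hdeg : Module.finrank F E = 3)
    {ρ : E →ₐ[F] E} (hρ : IsCubicGenerator ρ) {p₀ p₁ p₂ p₃ p₄ p₅ : E}
    (h : ∀ x, p₀ * x ^ 2 + p₁ * ρ x ^ 2 + p₂ * ρ (ρ x) ^ 2 + p₃ * (x * ρ x) +
      p₄ * (x * ρ (ρ x)) + p₅ * (ρ x * ρ (ρ x)) = 0) :
    p₀ = 0 ∧ p₁ = 0 ∧ p₂ = 0 ∧ p₃ = 0 ∧ p₄ = 0 ∧ p₅ = 0 := by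
  -- Polarise, then apply linear independence first in `x` and then in `y`. This kills the mixed
  -- coefficients and twice the square ones.
  have hpol : ∀ y x, (2 * p₀ * y + p₃ * ρ y + p₄ * ρ (ρ y)) * x +
      (p₃ * y + 2 * p₁ * ρ y + p₅ * ρ (ρ y)) * ρ x +
      (p₄ * y + p₅ * ρ y + 2 * p₂ * ρ (ρ y)) * ρ (ρ x) = 0 := fun y x => by
    have := h (x + y)
    simp only [map_add] at this
    linear_combination this - h x - h y
  have hrow : ∀ y, ∀ i, ![2 * p₀ * y + p₃ * ρ y + p₄ * ρ (ρ y),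
      p₃ * y + 2 * p₁ * ρ y + p₅ * ρ (ρ y), p₄ * y + p₅ * ρ y + 2 * p₂ * ρ (ρ y)] i = 0 :=
    fun y => hρ.eq_zero_of_sum_eq_zero hdeg fun x => by simpa using hpol y x
  have h0 := hρ.eq_zero_of_sum_eq_zero hdeg (c := ![2 * p₀, p₃, p₄])
    fun y => by simpa using hrow y 0
  have h1 := hρ.eq_zero_of_sum_eq_zero hdeg (c := ![p₃, 2 * p₁, p₅])
    fun y => by simpa using hrow y 1
  have h2 := hρ.eq_zero_of_sum_eq_zero hdeg (c := ![p₄, p₅, 2 * p₂])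
    fun y => by simpa using hrow y 2
  have h3 : p₃ = 0 := h0 1
  have h4 : p₄ = 0 := h0 2
  have h5 : p₅ = 0 := h1 2
  have hp0 : 2 * p₀ = 0 := h0 0
  have hp1 : 2 * p₁ = 0 := h1 1
  have hp2 : 2 * p₂ = 0 := h2 2
  -- In characteristic two the square terms are invisible to the polar form, but squaring is
  -- injective, so the squares of the three conjugates are again distinct characters.
  by_cases two : (2 : E) = 0
  · have hsq : ∀ {x y : E}, x ^ 2 = y ^ 2 → x = y := fun {x y} hxy => by
      have : (x - y) ^ 2 = 0 := by linear_combination hxy + (y ^ 2 - x * y) * two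
      exact sub_eq_zero.1 (pow_eq_zero_iff two_ne_zero |>.1 this)
    obtain ⟨t, t1, t2, t3⟩ := hρ.exists_distinct_conjugates hdeg
    have key := eq_zero_of_sum_monoidHom (c := ![p₀, p₁, p₂])
      (χ := ![powMonoidHom 2, (powMonoidHom 2).comp (ρ : E →* E),
        (powMonoidHom 2).comp ((ρ : E →* E).comp (ρ : E →* E))]) (by
      intro i j hij
      have := DFunLike.congr_fun hij t
      fin_cases i <;> fin_cases j <;> first
        | rfl
        | (exfalso; have := hsq this; first
            | exact t1 this | exact t1 this.symm | exact t2 this | exact t2 this.symm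
            | exact t3 this | exact t3 this.symm)) (by
      intro x
      have := h x
      simp only [h3, h4, h5] at this
      rw [Fin.sum_univ_three]
      change p₀ * x ^ 2 + p₁ * ρ x ^ 2 + p₂ * ρ (ρ x) ^ 2 = 0
      linear_combination this)
    exact ⟨key 0, key 1, key 2, h3, h4, h5⟩
  · simp only [mul_eq_zero, two, false_or] at hp0 hp1 hp2
    exact ⟨hp0, hp1, hp2, h3, h4, h5⟩

end GaloisQuadratic

/-! ### The Frobenius automorphism and frames of an exterior subplane -/

section Frobenius

variable {F E : Type*} [Field F] [Fintype F] [Field E] [Algebra F E]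

local notation "σ" => FiniteField.frobeniusAlgHom F E

lemma isCubicGenerator_frobenius (hdeg : Module.finrank F E = 3) :
    IsCubicGenerator σ := by
  have hfd : FiniteDimensional F E := FiniteDimensional.of_finrank_pos (by omega)
  have hfin : Finite E := Module.finite_of_finite F
  have := Fintype.ofFinite E
  have hcard : Fintype.card E = Fintype.card F ^ 3 := by
    rw [Module.card_eq_pow_finrank (K := F), hdeg]
  have htr : ∀ x, algebraMap F E (Algebra.trace F E x) = x + σ x + σ (σ x) := fun x => by
    rw [FiniteField.algebraMap_trace_eq_sum_pow, hdeg]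
    simp [Finset.sum_range_succ, Nat.card_eq_fintype_card, ← pow_mul, pow_two]
  refine ⟨fun x => ?_, htr, fun x hx => ?_⟩
  · simp only [FiniteField.coe_frobeniusAlgHom]
    rw [← pow_mul, ← pow_mul, ← mul_assoc, ← pow_three', ← hcard, FiniteField.pow_card]
  -- For `x` fixed by σ, the trace of `x * θ` equals `x` times the trace of `θ`, which is 1.
  · obtain ⟨θ, hθ⟩ := Algebra.trace_surjective F E 1
    refine ⟨Algebra.trace F E (x * θ), ?_⟩
    have h1 := htr θ
    rw [hθ, map_one] at h1
    rw [htr, map_mul, map_mul, hx, hx]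
    linear_combination (-x) * h1

lemma frobenius_sq_apply (x : E) : (σ ^ 2) x = σ (σ x) := by
  simp [pow_two]

lemma isCubicGenerator_frobenius_sq (hdeg : Module.finrank F E = 3) :
    IsCubicGenerator (σ ^ 2) := by
  have h := isCubicGenerator_frobenius hdeg (F := F) (E := E)
  refine ⟨fun x => ?_, fun x => ?_, fun x hx => h.fixed x ?_⟩
  · simp only [frobenius_sq_apply, h.cube]
  · simp only [frobenius_sq_apply, h.cube, h.trace]; ring
  · rw [frobenius_sq_apply] at hx
    have := h.cube x
    rwa [hx] at this

lemma normOne_eq : normOne F E = {k | k * σ k * σ (σ k) = 1} := by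
  ext k
  simp only [normOne, Set.mem_ofPred_eq, FiniteField.coe_frobeniusAlgHom]
  rw [← pow_mul, ← pow_succ', ← pow_add]
  ring_nf

/-- The vector of conjugates of an element of a cubic extension. -/
def conjugates (F : Type*) {E : Type*} [Field F] [Fintype F] [Field E] [Algebra F E] (w : E) :
    Fin 3 → E :=
  ![w, FiniteField.frobeniusAlgHom F E w,
    FiniteField.frobeniusAlgHom F E (FiniteField.frobeniusAlgHom F E w)]

lemma conjugates_ne_zero {w : E} (hw : w ≠ 0) : conjugates F w ≠ 0 :=
  fun h => hw (congrFun h 0)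

lemma conjugates_add (v w : E) : conjugates F (v + w) = conjugates F v + conjugates F w := by
  ext i; fin_cases i <;> simp [conjugates, -FiniteField.frobeniusAlgHom_apply]

lemma conjugates_smul (c : F) (w : E) :
    conjugates F (c • w) = algebraMap F E c • conjugates F w := by
  ext i; fin_cases i <;>
    simp [conjugates, -FiniteField.frobeniusAlgHom_apply, Algebra.smul_def]

/-- A nonzero linear form vanishing on all conjugate vectors would be a linear relation between id,
σ and σ². -/
lemma span_conjugates (hdeg : Module.finrank F E = 3) :
    Submodule.span E (Set.range (conjugates F (E := E))) = ⊤ := by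
  by_contra hne
  obtain ⟨f, hf0, hf⟩ := Submodule.exists_le_ker_of_lt_top _ (lt_top_iff_ne_top.2 hne)
  have key := (isCubicGenerator_frobenius (F := F) hdeg).eq_zero_of_sum_eq_zero hdeg
    (c := fun i => f (fun j => if i = j then 1 else 0)) fun x => by
      have h : f (conjugates F x) = 0 := hf (Submodule.subset_span ⟨x, rfl⟩)
      rw [LinearMap.pi_apply_eq_sum_univ f] at h
      simp only [Fin.sum_univ_three, conjugates, smul_eq_mul, Matrix.cons_val] at h
      linear_combination h
  refine hf0 (LinearMap.ext fun X => ?_)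
  rw [LinearMap.pi_apply_eq_sum_univ f]
  simp [key]

/-- Coordinates adapted to an exterior order-`q`-subplane: `a` maps the line `X 0 = 0` to the line
at infinity, and the subplane is the image of the points `(w, w ^ q, w ^ q ^ 2)`. -/
structure IsFrame (F : Type*) {E : Type*} [Field F] [Fintype F] [Field E] [Algebra F E]
    (a : (Fin 3 → E) ≃ₗ[E] (Fin 3 → E)) (π : Set (ℙ E (Fin 3 → E))) : Prop where
  last : ∀ X, a X 2 = X 0
  eq : π = {p | ∃ w ≠ 0, p.submodule = E ∙ a (conjugates F w)}

/-- The change of coordinates `B` keeps the first coordinate and sends conjugate vectors to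
multiples of conjugate vectors. This forces a quadratic identity in the conjugates of `w`; comparing
its coefficients leaves only diagonal matrices. -/
theorem IsFrame.exists_diagonal (hdeg : Module.finrank F E = 3)
    {a a' : (Fin 3 → E) ≃ₗ[E] (Fin 3 → E)} {π : Set (ℙ E (Fin 3 → E))}
    (ha : IsFrame F a π) (ha' : IsFrame F a' π) :
    ∃ e : E, e * σ e * σ (σ e) = 1 ∧ ∀ X, a' X = a ![X 0, e * X 1, e * σ e * X 2] := by
  have hσ := isCubicGenerator_frobenius (F := F) hdeg
  let B : (Fin 3 → E) ≃ₗ[E] (Fin 3 → E) := a'.trans a.symm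
  have hB : ∀ X, a (B X) = a' X := fun X => by simp [B]
  have hB0 : ∀ X, B X 0 = X 0 := fun X => by rw [← ha.last (B X), hB, ha'.last]
  have hexp : ∀ X i, B X i =
      X 0 * B ![1, 0, 0] i + X 1 * B ![0, 1, 0] i + X 2 * B ![0, 0, 1] i := by
    intro X i
    have : X = X 0 • ![1, 0, 0] + X 1 • ![0, 1, 0] + X 2 • ![0, 0, 1] := by
      ext j; fin_cases j <;> simp
    conv_lhs => rw [this]
    simp only [map_add, map_smul, Pi.add_apply, Pi.smul_apply, smul_eq_mul]
  have hpt : ∀ w ≠ 0, ∃ s w' : E, s ≠ 0 ∧ B (conjugates F w) = s • conjugates F w' := by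
    intro w hw
    have hne : a' (conjugates F w) ≠ 0 := by simpa using conjugates_ne_zero hw
    have hmem : Projectivization.mk E _ hne ∈ π := by
      rw [ha'.eq]
      exact ⟨w, hw, Projectivization.submodule_mk _ _⟩
    rw [ha.eq] at hmem
    obtain ⟨w', hw', h⟩ := hmem
    rw [Projectivization.submodule_mk] at h
    obtain ⟨s, hs⟩ := Submodule.mem_span_singleton.1 (h ▸ Submodule.mem_span_singleton_self _ :
      a' (conjugates F w) ∈ E ∙ a (conjugates F w'))
    refine ⟨s, w', ?_, ?_⟩
    · rintro rfl; exact hne (by rw [← hs, zero_smul])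
    · apply a.injective
      rw [hB, map_smul, hs]
  set b₀ := B ![1, 0, 0] 1
  set b₁ := B ![0, 1, 0] 1
  set b₂ := B ![0, 0, 1] 1
  set z₀ := B ![1, 0, 0] 2
  set z₁ := B ![0, 1, 0] 2
  set z₂ := B ![0, 0, 1] 2
  -- If the image is s·(w', σw', σ²w'), then w = s w', the second coordinate is Y = s σw' and the
  -- third is Z = s σ²w'. Eliminating s and w' gives Z σw = Y σY.
  have hrel : ∀ w, (w * z₀ + σ w * z₁ + σ (σ w) * z₂) * σ w =
      (w * b₀ + σ w * b₁ + σ (σ w) * b₂) * σ (w * b₀ + σ w * b₁ + σ (σ w) * b₂) := by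
    intro w
    by_cases hw : w = 0
    · simp [hw, -FiniteField.frobeniusAlgHom_apply]
    obtain ⟨s, w', hs, h⟩ := hpt w hw
    have h0 := congrFun h 0
    have h1 := congrFun h 1
    have h2 := congrFun h 2
    rw [hB0] at h0
    rw [hexp] at h1 h2
    simp only [conjugates, Pi.smul_apply, Matrix.cons_val, smul_eq_mul] at h0 h1 h2
    rw [h1, h2, h0]
    simp only [map_mul]
    ring
  obtain ⟨c0, c1, c2, c3, c4, c5⟩ := hσ.eq_zero_of_quadratic_eq_zero hdeg (p₀ := b₀ * σ b₂)
    (p₁ := b₁ * σ b₀ - z₁) (p₂ := b₂ * σ b₁) (p₃ := b₀ * σ b₀ + b₁ * σ b₂ - z₀)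
    (p₄ := b₀ * σ b₁ + b₂ * σ b₂) (p₅ := b₁ * σ b₁ + b₂ * σ b₀ - z₂) (fun w => by
      have := hrel w
      simp only [map_add, map_mul, hσ.cube] at this
      linear_combination -this)
  have hb2 : b₂ = 0 := by
    by_contra hb2
    have hσb2 : σ b₂ ≠ 0 := by rwa [Ne, map_eq_zero]
    have hb0 : b₀ = 0 := (mul_eq_zero.1 c0).resolve_right hσb2
    rw [hb0, zero_mul, zero_add] at c4
    exact (mul_ne_zero hb2 hσb2) c4
  have hb1 : b₁ ≠ 0 := by
    intro hb1
    have : B ![0, 0, 1] = 0 := by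
      ext i
      fin_cases i
      · simp [hB0]
      · exact hb2
      · change z₂ = 0
        rw [hb1, hb2] at c5
        simpa [-FiniteField.frobeniusAlgHom_apply] using c5
    rw [map_eq_zero_iff _ B.injective] at this
    simpa using congrFun this 2
  have hb0 : b₀ = 0 := by
    rw [hb2, zero_mul, add_zero] at c4
    refine (mul_eq_zero.1 c4).resolve_right ?_
    rwa [map_eq_zero]
  rw [hb0] at c5 c3 c1
  rw [hb2] at c5 c3
  simp only [map_zero, mul_zero, add_zero, zero_sub, neg_eq_zero, sub_eq_zero] at c5 c3 c1
  have hBX : ∀ X, B X = ![X 0, b₁ * X 1, b₁ * σ b₁ * X 2] := by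
    intro X
    ext i
    fin_cases i
    · exact hB0 X
    · refine (hexp X 1).trans ?_
      change X 0 * b₀ + X 1 * b₁ + X 2 * b₂ = b₁ * X 1
      rw [hb0, hb2]; ring
    · refine (hexp X 2).trans ?_
      change X 0 * z₀ + X 1 * z₁ + X 2 * z₂ = b₁ * σ b₁ * X 2
      rw [c3, c1, c5]; ring
  refine ⟨b₁, ?_, fun X => by rw [← hBX, hB]⟩
  -- At w = 1 the first coordinate gives 1 = s w' and the second gives b₁ = s σw', so N(b₁) = N(s
  -- w') = 1.
  obtain ⟨s, w', hs, h⟩ := hpt 1 one_ne_zero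
  rw [hBX] at h
  have h0 := congrFun h 0
  have h1 := congrFun h 1
  simp only [conjugates, Pi.smul_apply, Matrix.cons_val, smul_eq_mul, map_one, mul_one] at h0 h1
  have hn : s * σ s * σ (σ s) * (w' * σ w' * σ (σ w')) = 1 := by
    have : (s * w') * σ (s * w') * σ (σ (s * w')) = 1 := by
      rw [← h0]; simp [-FiniteField.frobeniusAlgHom_apply]
    simp only [map_mul] at this
    linear_combination this
  rw [h1]
  simp only [map_mul, hσ.cube]
  linear_combination hn

/-- Exteriority makes the last coordinate of `g` an F-isomorphism `φ` from F³ to E. Replacing each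
basis vector by the conjugate vector of its image under `φ` is invertible over E, and `g` composed
with the inverse of this replacement is the frame. The compatibility with `φ` lets dual coordinates
be read as traces later. -/
theorem exists_isFrame (hdeg : Module.finrank F E = 3) {π : Set (ℙ E (Fin 3 → E))}
    {g : (Fin 3 → E) ≃ₗ[E] (Fin 3 → E)} (hg : π = imageOfPG2q F g.toLinearMap)
    (hext : IsExteriorTo π (lineAtInfinity E)) :
    ∃ (a : (Fin 3 → E) ≃ₗ[E] (Fin 3 → E)) (φ : (Fin 3 → F) ≃ₗ[F] E), IsFrame F a π ∧
      ∀ v, a (conjugates F (φ v)) = g (fun i => algebraMap F E (v i)) := by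
  have hfd : FiniteDimensional F E := FiniteDimensional.of_finrank_pos (by omega)
  let f : (Fin 3 → F) →ₗ[F] E :=
    { toFun := fun v => g (fun i => algebraMap F E (v i)) 2
      map_add' := fun v w => by
        have : (fun i => algebraMap F E ((v + w) i)) =
          (fun i => algebraMap F E (v i)) + fun i => algebraMap F E (w i) := by ext i; simp
        rw [this, map_add, Pi.add_apply]
      map_smul' := fun c v => by
        have : (fun i => algebraMap F E ((c • v) i)) =
          algebraMap F E c • fun i => algebraMap F E (v i) := by ext i; simp
        rw [this, map_smul]; simp [Algebra.smul_def] }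
  have hf : ∀ v, f v = g (fun i => algebraMap F E (v i)) 2 := fun v => rfl
  have hinj : Function.Injective f := by
    rw [injective_iff_map_eq_zero]
    intro v hv
    by_contra hv0
    have hne : (fun i => algebraMap F E (v i)) ≠ 0 := by
      intro h
      exact hv0 (funext fun i => (algebraMap F E).injective (by simpa using congrFun h i))
    have hgne : g (fun i => algebraMap F E (v i)) ≠ 0 := by simpa using hne
    have hπ : Projectivization.mk E _ hgne ∈ π := by
      rw [hg]
      exact ⟨v, hv0, Projectivization.submodule_mk _ _⟩
    refine Set.disjoint_left.1 hext hπ ?_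
    refine (mk_mem_pts hgne).2 ?_
    simpa [lineAtInfinity, hf] using hv
  let φ : (Fin 3 → F) ≃ₗ[F] E := LinearEquiv.ofInjectiveOfFinrankEq f hinj (by simp [hdeg])
  have hφ : ∀ v, φ v = f v := fun v => rfl
  let b₀ : (Fin 3 → E) →ₗ[E] (Fin 3 → E) :=
    Fintype.linearCombination E fun i => conjugates F (φ (Pi.single i 1))
  have hb₀ : ∀ v : Fin 3 → F, b₀ (fun i => algebraMap F E (v i)) = conjugates F (φ v) := by
    intro v
    rw [Fintype.linearCombination_apply]
    have : v = ∑ i, v i • Pi.single i (1 : F) := by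
      ext j; simp [Finset.sum_apply, Pi.single_apply]
    conv_rhs => rw [this, map_sum]
    simp only [Fin.sum_univ_three, conjugates_add, map_smul, conjugates_smul]
  have hsurj : Function.Surjective b₀ := by
    rw [← LinearMap.range_eq_top, eq_top_iff, ← span_conjugates (F := F) hdeg, Submodule.span_le]
    rintro _ ⟨w, rfl⟩
    exact ⟨_, (hb₀ (φ.symm w)).trans (by simp)⟩
  let b : (Fin 3 → E) ≃ₗ[E] (Fin 3 → E) :=
    LinearEquiv.ofBijective b₀ ⟨LinearMap.injective_iff_surjective.2 hsurj, hsurj⟩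
  have hb : ∀ X, b X = b₀ X := fun X => rfl
  have key : ∀ v, (b.symm.trans g) (conjugates F (φ v)) = g (fun i => algebraMap F E (v i)) := by
    intro v
    rw [LinearEquiv.trans_apply, ← hb₀, ← hb, LinearEquiv.symm_apply_apply]
  have hlast : (LinearMap.proj 2 : (Fin 3 → E) →ₗ[E] E) ∘ₗ (b.symm.trans g).toLinearMap =
      LinearMap.proj 0 := by
    refine LinearMap.ext_on_range (span_conjugates (F := F) hdeg) fun w => ?_
    have := key (φ.symm w)
    simp only [LinearEquiv.apply_symm_apply] at this
    simp only [LinearMap.comp_apply, LinearEquiv.coe_coe, this, LinearMap.proj_apply]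
    rw [← hf, ← hφ, LinearEquiv.apply_symm_apply]
    rfl
  refine ⟨b.symm.trans g, φ, ⟨fun X => LinearMap.congr_fun hlast X, ?_⟩, key⟩
  rw [hg]
  ext p
  constructor
  · rintro ⟨v, hv, hp⟩
    exact ⟨φ v, by simpa using hv, by rw [key]; exact hp⟩
  · rintro ⟨w, hw, hp⟩
    refine ⟨φ.symm w, by simpa using hw, ?_⟩
    rw [hp, ← φ.apply_symm_apply w, key, LinearEquiv.apply_symm_apply]
    rfl

end Frobenius

/-! ### Spread planes and covers in frame coordinates -/

section Frames

variable {F E : Type*} [Field F] [Field E] [Algebra F E]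

local notation "σ" => FiniteField.frobeniusAlgHom F E

/-! ### The hyperplane at infinity in the coordinates of a frame -/

/-- The `F`-linear map `(x, y) ↦ a (0, x, y)` into the hyperplane at infinity. -/
def frameInfinity (F : Type*) {E : Type*} [Field F] [Field E] [Algebra F E]
    (a : (Fin 3 → E) ≃ₗ[E] (Fin 3 → E)) : E × E →ₗ[F] E × E × F :=
  toInfinity F E ∘ₗ a.toLinearMap.restrictScalars F ∘ₗ
    LinearMap.pi ![0, LinearMap.fst F E E, LinearMap.snd F E E]

variable {a : (Fin 3 → E) ≃ₗ[E] (Fin 3 → E)} {π : Set (ℙ E (Fin 3 → E))}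

lemma frameInfinity_apply (x y : E) :
    frameInfinity F a (x, y) = (a ![0, x, y] 0, a ![0, x, y] 1, 0) := by
  have : (LinearMap.pi ![0, LinearMap.fst F E E, LinearMap.snd F E E] : E × E →ₗ[F] _) (x, y) =
      ![0, x, y] := by
    ext i; fin_cases i <;> rfl
  rw [frameInfinity, LinearMap.comp_apply, LinearMap.comp_apply, this]
  rfl

lemma frameInfinity_injective (ha : ∀ X, a X 2 = X 0) :
    Function.Injective (frameInfinity F a) := by
  rw [injective_iff_map_eq_zero]
  rintro ⟨x, y⟩ h
  rw [frameInfinity_apply] at h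
  have h0 : a ![0, x, y] = 0 := by
    ext i
    fin_cases i
    · exact congrArg Prod.fst h
    · exact congrArg (fun v => v.2.1) h
    · exact ha _
  rw [map_eq_zero_iff _ a.injective] at h0
  exact Prod.ext (congrFun h0 1) (congrFun h0 2)

lemma range_frameInfinity (ha : ∀ X, a X 2 = X 0) :
    LinearMap.range (frameInfinity F a) = hyperplaneAtInfinity F E := by
  ext ⟨x, y, z⟩
  constructor
  · rintro ⟨⟨m, n⟩, h⟩
    rw [frameInfinity_apply] at h
    exact (congrArg (fun v => v.2.2) h).symm
  · intro h
    have hz : z = 0 := h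
    have h0 : a.symm ![x, y, 0] 0 = 0 := by rw [← ha (a.symm _)]; simp
    have hX : ![0, a.symm ![x, y, 0] 1, a.symm ![x, y, 0] 2] = a.symm ![x, y, 0] := by
      ext i; fin_cases i <;> simp [h0]
    refine ⟨(a.symm ![x, y, 0] 1, a.symm ![x, y, 0] 2), ?_⟩
    rw [frameInfinity_apply, hX, hz]
    simp

lemma ruledPlane_frameInfinity {ρ : E →ₐ[F] E} {b : E} {p : ℙ E (Fin 3 → E)}
    (hp : p.submodule = E ∙ a ![0, b, -ρ b]) :
    spreadPlane F p = ruledPlane (frameInfinity F a) ρ b := by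
  have key : ∀ m : E, frameInfinity F a (b * m, -ρ b * m) =
      toInfinity F E (m • a ![0, b, -ρ b]) := by
    intro m
    have : m • ![0, b, -ρ b] = ![0, b * m, -ρ b * m] := by
      ext i; fin_cases i <;> simp [mul_comm]
    rw [frameInfinity_apply, ← map_smul, this]
    rfl
  ext v
  rw [spreadPlane, hp, mem_ruledPlane_iff_exists]
  constructor
  · rintro ⟨X, hX, rfl⟩
    obtain ⟨m, rfl⟩ := Submodule.mem_span_singleton.1 hX
    exact ⟨m, key m⟩
  · rintro ⟨m, rfl⟩
    exact ⟨_, Submodule.mem_span_singleton.2 ⟨m, rfl⟩, (key m).symm⟩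

/-! ### Homographies fixing the line at infinity -/

lemma apply_two_of_fixes {g : (Fin 3 → E) ≃ₗ[E] (Fin 3 → E)}
    (hg : actLine g (lineAtInfinity E) = lineAtInfinity E) :
    g ![0, 0, 1] 2 ≠ 0 ∧ ∀ Y, g Y 2 = g ![0, 0, 1] 2 * Y 2 := by
  have hfix : ∀ Y : Fin 3 → E, Y 2 = 0 → g Y 2 = 0 := fun Y hY => by
    have : g Y ∈ lineAtInfinity E := by
      rw [← hg]
      exact ⟨Y, hY, rfl⟩
    exact this
  constructor
  · intro h
    have : g ![0, 0, 1] ∈ actLine g (lineAtInfinity E) := by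
      rw [hg]; exact h
    obtain ⟨Y, hY, hYg⟩ := this
    have hY' : Y = ![0, 0, 1] := g.injective hYg
    have hY2 : Y 2 = 0 := hY
    rw [hY'] at hY2
    simp at hY2
  · intro Y
    have hY : Y = ![Y 0, Y 1, 0] + Y 2 • ![0, 0, 1] := by
      ext i; fin_cases i <;> simp
    conv_lhs => rw [hY]
    rw [map_add, map_smul, Pi.add_apply, hfix _ (by simp)]
    simp [mul_comm]

/-- The frame obtained by applying a homography that fixes the line at infinity. -/
def transportFrame (g a : (Fin 3 → E) ≃ₗ[E] (Fin 3 → E)) (hs : g ![0, 0, 1] 2 ≠ 0) :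
    (Fin 3 → E) ≃ₗ[E] (Fin 3 → E) :=
  (a.trans g).trans (LinearEquiv.smulOfNeZero E _ _ (inv_ne_zero hs))

lemma transportFrame_apply {g : (Fin 3 → E) ≃ₗ[E] (Fin 3 → E)} (hs : g ![0, 0, 1] 2 ≠ 0)
    (X : Fin 3 → E) : transportFrame g a hs X = (g ![0, 0, 1] 2)⁻¹ • g (a X) := rfl

/-- Both `induced` and `transportFrame` divide by the same constant, the factor by which `g` scales
the last coordinate. -/
lemma induced_frameInfinity (ha : ∀ X, a X 2 = X 0) {g : (Fin 3 → E) ≃ₗ[E] (Fin 3 → E)}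
    (hs : g ![0, 0, 1] 2 ≠ 0) (v : E × E) :
    induced F g (frameInfinity F a v) = frameInfinity F (transportFrame g a hs) v := by
  obtain ⟨x, y⟩ := v
  rw [frameInfinity_apply, frameInfinity_apply]
  have : (![a ![0, x, y] 0, a ![0, x, y] 1, algebraMap F E 0] : Fin 3 → E) = a ![0, x, y] := by
    ext i; fin_cases i <;> simp [ha]
  simp only [transportFrame_apply, induced, LinearMap.coe_mk, AddHom.coe_mk, this, Pi.smul_apply,
    smul_eq_mul]

lemma map_induced_graphPlane (ha : ∀ X, a X 2 = X 0) {g : (Fin 3 → E) ≃ₗ[E] (Fin 3 → E)}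
    (hs : g ![0, 0, 1] 2 ≠ 0) (ρ : E →ₐ[F] E) (k : E) :
    (graphPlane (frameInfinity F a) ρ k).map (induced F g) =
      graphPlane (frameInfinity F (transportFrame g a hs)) ρ k := by
  rw [graphPlane, ← LinearMap.range_comp, graphPlane]
  congr 1
  ext1 x
  exact induced_frameInfinity ha hs _

/-- Substituting `e * x` for `x` in y = -kρ(x) divides by `ρ e`, while rescaling `y` multiplies by
`f`. -/
lemma graphPlane_diagonal {a a' : (Fin 3 → E) ≃ₗ[E] (Fin 3 → E)} {e f : E} (he : e ≠ 0)
    (h : ∀ X, a' X = a ![X 0, e * X 1, f * X 2]) (ρ : E →ₐ[F] E) (k : E) :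
    graphPlane (frameInfinity F a') ρ k = graphPlane (frameInfinity F a) ρ (k * f / ρ e) := by
  have hρe : ρ e ≠ 0 := by rwa [Ne, map_eq_zero]
  have hJ : ∀ x y, frameInfinity F a' (x, y) = frameInfinity F a (e * x, f * y) := by
    intro x y
    rw [frameInfinity_apply, frameInfinity_apply, h]
    rfl
  ext v
  constructor
  · rintro ⟨m, rfl⟩
    refine ⟨e * m, ?_⟩
    change frameInfinity F a (e * m, -(k * f / ρ e) * ρ (e * m)) =
      frameInfinity F a' (m, -k * ρ m)
    rw [hJ, map_mul]
    congr 2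
    field_simp
  · rintro ⟨m, rfl⟩
    refine ⟨m / e, ?_⟩
    change frameInfinity F a' (m / e, -k * ρ (m / e)) =
      frameInfinity F a (m, -(k * f / ρ e) * ρ m)
    rw [hJ, map_div₀]
    congr 2 <;> field_simp

/-- The coordinates adapted to `baseSubplane`. -/
def baseFrame (δ δ' : E) (h : δ ≠ 0) (h' : δ' ≠ 0) : (Fin 3 → E) ≃ₗ[E] (Fin 3 → E) where
  toFun X := ![(X 2 - X 0) / δ', (X 1 - X 0) / δ, X 0]
  invFun Y := ![Y 2, δ * Y 1 + Y 2, δ' * Y 0 + Y 2]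
  map_add' X Y := by ext i; fin_cases i <;> simp <;> ring
  map_smul' c X := by ext i; fin_cases i <;> simp <;> ring
  left_inv X := by ext i; fin_cases i <;> simp <;> field_simp <;> ring
  right_inv Y := by ext i; fin_cases i <;> simp <;> field_simp

lemma baseFrame_apply {δ δ' : E} (h : δ ≠ 0) (h' : δ' ≠ 0) (X : Fin 3 → E) :
    baseFrame δ δ' h h' X = ![(X 2 - X 0) / δ', (X 1 - X 0) / δ, X 0] := rfl

lemma frameInfinity_baseFrame {δ δ' : E} (h : δ ≠ 0) (h' : δ' ≠ 0) (x y : E) :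
    frameInfinity F (baseFrame δ δ' h h') (x, y) = (y / δ', x / δ, 0) := by
  rw [frameInfinity_apply, baseFrame_apply]
  simp

variable [Fintype F]

lemma IsFrame.mk_mem (ha : IsFrame F a π) {w : E} (hw : w ≠ 0)
    (hv : a (conjugates F w) ≠ 0) : Projectivization.mk E _ hv ∈ π := by
  rw [ha.eq]
  exact ⟨w, hw, Projectivization.submodule_mk _ _⟩

lemma conjugates_frame_ne_zero {w : E} (hw : w ≠ 0) : a (conjugates F w) ≠ 0 := by
  simpa using conjugates_ne_zero hw

lemma IsFrame.transport (ha : IsFrame F a π) {g : (Fin 3 → E) ≃ₗ[E] (Fin 3 → E)}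
    (hg : actLine g (lineAtInfinity E) = lineAtInfinity E) :
    IsFrame F (transportFrame g a (apply_two_of_fixes hg).1) (actPoints g π) := by
  obtain ⟨hs, h2⟩ := apply_two_of_fixes hg
  refine ⟨fun X => ?_, ?_⟩
  · rw [transportFrame_apply, Pi.smul_apply, h2 (a X), ha.last, smul_eq_mul,
      inv_mul_cancel_left₀ hs]
  · ext p
    constructor
    · rintro ⟨r, hr, rfl⟩
      rw [ha.eq] at hr
      obtain ⟨w, hw, hrw⟩ := hr
      refine ⟨w, hw, ?_⟩
      rw [transportFrame_apply, Submodule.span_singleton_smul_eq (IsUnit.mk0 _ (inv_ne_zero hs))]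
      have : r = Projectivization.mk E _ (conjugates_frame_ne_zero (F := F) (a := a) hw) :=
        Projectivization.submodule_injective (by rw [hrw, Projectivization.submodule_mk])
      rw [this, Projectivization.map_mk, Projectivization.submodule_mk]
      rfl
    · rintro ⟨w, hw, hp⟩
      refine ⟨_, ha.mk_mem hw (conjugates_frame_ne_zero hw), ?_⟩
      apply Projectivization.submodule_injective
      rw [hp, transportFrame_apply,
        Submodule.span_singleton_smul_eq (IsUnit.mk0 _ (inv_ne_zero hs)), Projectivization.map_mk,
        Projectivization.submodule_mk]
      rfl

/-! ### The covers do not depend on the frame -/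

/-- The cover belonging to the automorphism `ρ`, in the coordinates of the frame `a`. -/
def frameCover (a : (Fin 3 → E) ≃ₗ[E] (Fin 3 → E)) (ρ : E →ₐ[F] E) :
    Set (Submodule F (E × E × F)) :=
  graphPlane (frameInfinity F a) ρ '' {k | k * ρ k * ρ (ρ k) = 1}

/-- The diagonal change of frame replaces `k` by `k * (e * σ e) / ρ e`, and `e` has norm one, so
norm-one parameters stay norm-one. By symmetry one inclusion is enough. -/
theorem IsFrame.frameCover_eq (hdeg : Module.finrank F E = 3)
    {a a' : (Fin 3 → E) ≃ₗ[E] (Fin 3 → E)} (ha : IsFrame F a π) (ha' : IsFrame F a' π)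
    {ρ : E →ₐ[F] E} (hρ : IsCubicGenerator ρ)
    (hN : ∀ x, x * ρ x * ρ (ρ x) = x * σ x * σ (σ x)) :
    frameCover a' ρ = frameCover a ρ := by
  have hσ := isCubicGenerator_frobenius (F := F) hdeg
  have key : ∀ {a a' : (Fin 3 → E) ≃ₗ[E] (Fin 3 → E)}, IsFrame F a π → IsFrame F a' π →
      frameCover a' ρ ⊆ frameCover a ρ := by
    rintro a a' ha ha' _ ⟨k, hk, rfl⟩
    obtain ⟨e, he, h⟩ := ha.exists_diagonal hdeg ha'
    have he0 : e ≠ 0 := by rintro rfl; simp at he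
    have hρe : ρ e ≠ 0 := by rwa [Ne, map_eq_zero]
    have hρρe : ρ (ρ e) ≠ 0 := by rwa [Ne, map_eq_zero]
    rw [graphPlane_diagonal he0 h]
    refine ⟨_, ?_, rfl⟩
    have hf : (e * σ e) * ρ (e * σ e) * ρ (ρ (e * σ e)) = 1 := by
      rw [hN]
      simp only [map_mul, hσ.cube]
      linear_combination (e * σ e * σ (σ e) + 1) * he
    rw [← hN] at he
    have hk' : k * ρ k * ρ (ρ k) = 1 := hk
    change (k * (e * σ e) / ρ e) * ρ (k * (e * σ e) / ρ e) * ρ (ρ (k * (e * σ e) / ρ e)) = 1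
    rw [map_div₀, map_div₀, hρ.cube, map_mul, map_mul ρ (ρ k)]
    have : ρ e * ρ (ρ e) * e = 1 := by linear_combination he
    rw [div_mul_div_comm, div_mul_div_comm, this, div_one]
    linear_combination hk' * (e * σ e) * ρ (e * σ e) * ρ (ρ (e * σ e)) + hf
  exact (key ha ha').antisymm (key ha' ha)

/-! ### The base subplane -/

lemma primitive_not_fixed (hdeg : Module.finrank F E = 3) {τ : E}
    (hτ : ∀ x : E, x ≠ 0 → ∃ n : ℕ, τ ^ n = x) : σ τ ≠ τ := by
  intro h
  obtain ⟨t, ht, -⟩ := (isCubicGenerator_frobenius (F := F) hdeg).exists_distinct_conjugates hdeg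
  have ht0 : t ≠ 0 := by rintro rfl; exact ht (map_zero _)
  obtain ⟨n, rfl⟩ := hτ t ht0
  exact ht (by rw [map_pow, h])

/-- Let f(v) be the last coordinate of the image of v under the matrix K. Its first two coordinates
are (σ²f - f)/(στ - σ²τ) and (σf - f)/(τ - σ²τ), so the vector is recovered from the conjugates of
f; this is what dictates `baseFrame`. -/
lemma isFrame_baseFrame (hdeg : Module.finrank F E = 3) {τ : E} (hτ : σ τ ≠ τ)
    (h : τ - σ (σ τ) ≠ 0) (h' : σ τ - σ (σ τ) ≠ 0) :
    IsFrame F (baseFrame (τ - σ (σ τ)) (σ τ - σ (σ τ)) h h') (baseSubplane F τ) := by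
  have hσ := isCubicGenerator_frobenius (F := F) hdeg
  have hfd : FiniteDimensional F E := FiniteDimensional.of_finrank_pos (by omega)
  let f : (Fin 3 → F) →ₗ[F] E := Fintype.linearCombination F ![τ * σ τ, -(τ + σ τ), 1]
  have hf : ∀ v, f v = algebraMap F E (v 0) * (τ * σ τ) - algebraMap F E (v 1) * (τ + σ τ) +
      algebraMap F E (v 2) := by
    intro v
    simp [f, Fintype.linearCombination_apply, Fin.sum_univ_three, Algebra.smul_def,
      -FiniteField.frobeniusAlgHom_apply]
    ring
  have hK : ∀ v : Fin 3 → F, Matrix.mulVecLin !![-τ, 1, 0; -τ ^ Fintype.card F, 1, 0;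
      τ * τ ^ Fintype.card F, -τ - τ ^ Fintype.card F, 1] (fun i => algebraMap F E (v i)) =
      ![-τ * algebraMap F E (v 0) + algebraMap F E (v 1),
        -σ τ * algebraMap F E (v 0) + algebraMap F E (v 1), f v] := by
    intro v
    rw [hf]
    ext i
    fin_cases i <;> simp [Matrix.mulVec, dotProduct, Fin.sum_univ_three]
    ring
  have key : ∀ v : Fin 3 → F, baseFrame (τ - σ (σ τ)) (σ τ - σ (σ τ)) h h' (conjugates F (f v)) =
      ![-τ * algebraMap F E (v 0) + algebraMap F E (v 1),
        -σ τ * algebraMap F E (v 0) + algebraMap F E (v 1), f v] := by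
    intro v
    rw [baseFrame_apply]
    have h1 : σ (f v) = algebraMap F E (v 0) * (σ τ * σ (σ τ)) -
        algebraMap F E (v 1) * (σ τ + σ (σ τ)) + algebraMap F E (v 2) := by
      simp only [hf, map_add, map_sub, map_mul, AlgHom.commutes]
    have h2 : σ (σ (f v)) = algebraMap F E (v 0) * (σ (σ τ) * τ) -
        algebraMap F E (v 1) * (σ (σ τ) + τ) + algebraMap F E (v 2) := by
      simp only [h1, map_add, map_sub, map_mul, AlgHom.commutes, hσ.cube]
    ext i
    fin_cases i
    · change (σ (σ (f v)) - f v) / _ = _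
      rw [h2, hf, div_eq_iff h']
      simp only [Fin.zero_eta, Matrix.cons_val]
      ring
    · change (σ (f v) - f v) / _ = _
      rw [h1, hf, div_eq_iff h]
      simp only [Fin.mk_one, Matrix.cons_val]
      ring
    · rfl
  have hinj : Function.Injective f := by
    rw [injective_iff_map_eq_zero]
    intro v hv
    have hz := key v
    rw [hv] at hz
    have h0 : conjugates F (0 : E) = 0 := by simpa using conjugates_smul (0 : F) (0 : E)
    rw [h0, map_zero] at hz
    have e0 := congrFun hz 0
    have e1 := congrFun hz 1
    simp only [Pi.zero_apply, Matrix.cons_val] at e0 e1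
    have hv0 : algebraMap F E (v 0) = 0 := by
      apply mul_left_cancel₀ (sub_ne_zero.2 hτ)
      linear_combination e1 - e0
    have hv1 : algebraMap F E (v 1) = 0 := by
      linear_combination -e0 + τ * hv0
    have hv2 : algebraMap F E (v 2) = 0 := by
      have := hf v
      rw [hv, hv0, hv1] at this
      linear_combination -this
    rw [map_eq_zero] at hv0 hv1 hv2
    ext i; fin_cases i <;> assumption
  let φ : (Fin 3 → F) ≃ₗ[F] E := LinearEquiv.ofInjectiveOfFinrankEq f hinj (by simp [hdeg])
  have hφ : ∀ v, φ v = f v := fun v => rfl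
  refine ⟨fun X => rfl, ?_⟩
  ext p
  constructor
  · rintro ⟨v, hv, hp⟩
    exact ⟨φ v, by simpa using hv, by rw [hp, hφ, key, hK]⟩
  · rintro ⟨w, hw, hp⟩
    refine ⟨φ.symm w, by simpa using hw, ?_⟩
    rw [hK, ← key, ← hφ, LinearEquiv.apply_symm_apply]
    exact hp

/-- The first frame coordinate at infinity is m = δ σx with δ = τ - σ²τ. Then x is σ²m / σ²δ, and
σ²δ = -(στ - σ²τ) cancels the other denominator, so the same `k` occurs on both sides. -/
lemma planeT_eq (hdeg : Module.finrank F E = 3) {τ : E}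
    (h : τ - σ (σ τ) ≠ 0) (h' : σ τ - σ (σ τ) ≠ 0) (k : E) :
    planeT F k = graphPlane (frameInfinity F (baseFrame _ _ h h')) (σ ^ 2) k := by
  have hσ := isCubicGenerator_frobenius (F := F) hdeg
  have key : ∀ x, (k * x, σ x, (0 : F)) = frameInfinity F (baseFrame _ _ h h')
      ((τ - σ (σ τ)) * σ x, -k * (σ ^ 2) ((τ - σ (σ τ)) * σ x)) := by
    intro x
    rw [frameInfinity_baseFrame, frobenius_sq_apply]
    simp only [map_mul, map_sub, hσ.cube, Prod.mk.injEq, and_true]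
    constructor
    · rw [eq_div_iff h']; ring
    · rw [mul_div_cancel_left₀ _ h]
  ext v
  constructor
  · rintro ⟨x, rfl⟩
    exact ⟨_, (key x).symm⟩
  · rintro ⟨m, rfl⟩
    refine ⟨σ (σ (m / (τ - σ (σ τ)))), ?_⟩
    refine (key _).trans ?_
    rw [hσ.cube, mul_div_cancel₀ _ h]
    rfl

/-- Here m = δ σ²x with δ = τ - σ²τ, so x = σm / σδ, while the denominator of the frame is -σ²δ.
Their quotient is the correction factor of `k`; it has norm one and disappears in `image_planeC`. -/
lemma planeC_eq (hdeg : Module.finrank F E = 3) {τ : E}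
    (h : τ - σ (σ τ) ≠ 0) (h' : σ τ - σ (σ τ) ≠ 0) (k : E) :
    planeC F k = graphPlane (frameInfinity F (baseFrame _ _ h h')) σ
      (k * (σ (σ (τ - σ (σ τ))) / σ (τ - σ (σ τ)))) := by
  have hσ := isCubicGenerator_frobenius (F := F) hdeg
  have h1 : σ (τ - σ (σ τ)) ≠ 0 := by rwa [Ne, map_eq_zero]
  have key : ∀ x, (k * x, (σ ^ 2) x, (0 : F)) = frameInfinity F (baseFrame _ _ h h')
      ((τ - σ (σ τ)) * σ (σ x), -(k * (σ (σ (τ - σ (σ τ))) / σ (τ - σ (σ τ)))) *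
        σ ((τ - σ (σ τ)) * σ (σ x))) := by
    intro x
    rw [frameInfinity_baseFrame, frobenius_sq_apply, map_mul, hσ.cube, Prod.mk.injEq, Prod.mk.injEq]
    refine ⟨?_, ?_, rfl⟩
    · rw [eq_div_iff h']
      field_simp
      simp only [map_sub, hσ.cube]
      ring
    · rw [mul_div_cancel_left₀ _ h]
  ext v
  constructor
  · rintro ⟨x, rfl⟩
    exact ⟨_, (key x).symm⟩
  · rintro ⟨m, rfl⟩
    refine ⟨σ (m / (τ - σ (σ τ))), ?_⟩
    refine (key _).trans ?_
    rw [hσ.cube, mul_div_cancel₀ _ h]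
    rfl

lemma image_planeT (hdeg : Module.finrank F E = 3) {τ : E}
    (h : τ - σ (σ τ) ≠ 0) (h' : σ τ - σ (σ τ) ≠ 0) :
    planeT F '' normOne F E = frameCover (baseFrame _ _ h h') (σ ^ 2) := by
  have hσ := isCubicGenerator_frobenius (F := F) hdeg
  rw [frameCover, normOne_eq]
  have : {k : E | k * σ k * σ (σ k) = 1} = {k | k * (σ ^ 2) k * (σ ^ 2) ((σ ^ 2) k) = 1} := by
    ext k
    simp only [Set.mem_ofPred_eq, frobenius_sq_apply, hσ.cube]
    rw [mul_right_comm]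
  rw [this]
  exact Set.image_congr fun k _ => planeT_eq hdeg h h' k

lemma image_planeC (hdeg : Module.finrank F E = 3) {τ : E}
    (h : τ - σ (σ τ) ≠ 0) (h' : σ τ - σ (σ τ) ≠ 0) :
    planeC F '' normOne F E = frameCover (baseFrame _ _ h h') σ := by
  have hσ := isCubicGenerator_frobenius (F := F) hdeg
  have h1 : σ (τ - σ (σ τ)) ≠ 0 := by rwa [Ne, map_eq_zero]
  have h2 : σ (σ (τ - σ (σ τ))) ≠ 0 := by rwa [Ne, map_eq_zero]
  rw [frameCover, normOne_eq]
  set δ := τ - σ (σ τ)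
  have hnorm : ∀ k, k * (σ (σ δ) / σ δ) * σ (k * (σ (σ δ) / σ δ)) *
      σ (σ (k * (σ (σ δ) / σ δ))) = k * σ k * σ (σ k) := by
    intro k
    simp only [map_mul, map_div₀, hσ.cube]
    field_simp
  ext P
  constructor
  · rintro ⟨k, hk, rfl⟩
    exact ⟨_, (hnorm k).trans hk, (planeC_eq hdeg h h' k).symm⟩
  · rintro ⟨k, hk, rfl⟩
    have hk' : k / (σ (σ δ) / σ δ) * (σ (σ δ) / σ δ) = k := by field_simp
    refine ⟨k / (σ (σ δ) / σ δ), ?_, ?_⟩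
    · change _ = _
      rw [← hnorm, hk']
      exact hk
    · rw [planeC_eq hdeg h h', hk']

end Frames

/-! ### Pencil sublines and special dual conics in frame coordinates -/

section Sublines

variable {F E : Type*} [Field F] [Field E] [Algebra F E]

lemma ne_zero_of_forall_smul_ne {w w' : E} (h : ∀ x : F, x • w ≠ w') : w' ≠ 0 := by
  rintro rfl
  exact h 0 (zero_smul _ _)

lemma exists_quadratic_coefficients {Q : MvPolynomial (Fin 3) F} (hQ : Q.IsHomogeneous 2) :
    ∃ q₀ q₁ q₂ q₃ q₄ q₅ : F, Q = MvPolynomial.C q₀ * MvPolynomial.X 0 ^ 2 +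
      MvPolynomial.C q₁ * MvPolynomial.X 1 ^ 2 + MvPolynomial.C q₂ * MvPolynomial.X 2 ^ 2 +
      MvPolynomial.C q₃ * (MvPolynomial.X 0 * MvPolynomial.X 1) +
      MvPolynomial.C q₄ * (MvPolynomial.X 0 * MvPolynomial.X 2) +
      MvPolynomial.C q₅ * (MvPolynomial.X 1 * MvPolynomial.X 2) := by
  rw [Q.as_sum]
  refine Finset.sum_induction _ (fun P : MvPolynomial (Fin 3) F => ∃ q₀ q₁ q₂ q₃ q₄ q₅ : F, P =
      MvPolynomial.C q₀ * MvPolynomial.X 0 ^ 2 +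
      MvPolynomial.C q₁ * MvPolynomial.X 1 ^ 2 + MvPolynomial.C q₂ * MvPolynomial.X 2 ^ 2 +
      MvPolynomial.C q₃ * (MvPolynomial.X 0 * MvPolynomial.X 1) +
      MvPolynomial.C q₄ * (MvPolynomial.X 0 * MvPolynomial.X 2) +
      MvPolynomial.C q₅ * (MvPolynomial.X 1 * MvPolynomial.X 2)) ?_ ?_ ?_
  · rintro P P' ⟨q₀, q₁, q₂, q₃, q₄, q₅, rfl⟩ ⟨r₀, r₁, r₂, r₃, r₄, r₅, rfl⟩
    refine ⟨q₀ + r₀, q₁ + r₁, q₂ + r₂, q₃ + r₃, q₄ + r₄, q₅ + r₅, ?_⟩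
    simp only [map_add]
    ring
  · exact ⟨0, 0, 0, 0, 0, 0, by simp⟩
  · intro m hm
    have hdegm : m.degree = 2 := by
      by_contra hne
      exact MvPolynomial.mem_support_iff.1 hm (hQ.coeff_eq_zero hne)
    rw [Finsupp.degree_eq_sum, Fin.sum_univ_three] at hdegm
    rw [MvPolynomial.monomial_eq, Finsupp.prod_fintype _ _ (fun _ => pow_zero _),
      Fin.prod_univ_three]
    generalize MvPolynomial.coeff m Q = c
    have h0 : m 0 ≤ 2 := by omega
    have h1 : m 1 ≤ 2 := by omega
    obtain h2 : m 2 = 2 - m 0 - m 1 := by omega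
    rw [h2]
    generalize m 0 = i at *
    generalize m 1 = j at *
    interval_cases i <;> interval_cases j <;> try omega
    · exact ⟨0, 0, c, 0, 0, 0, by simp⟩
    · exact ⟨0, 0, 0, 0, 0, c, by simp⟩
    · exact ⟨0, c, 0, 0, 0, 0, by simp⟩
    · exact ⟨0, 0, 0, 0, c, 0, by simp⟩
    · exact ⟨0, 0, 0, c, 0, 0, by simp⟩
    · exact ⟨c, 0, 0, 0, 0, 0, by simp⟩

variable [Fintype F]

local notation "σ" => FiniteField.frobeniusAlgHom F E

variable {a : (Fin 3 → E) ≃ₗ[E] (Fin 3 → E)} {π : Set (ℙ E (Fin 3 → E))}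

/-! ### Lines of the subplane -/

lemma finrank_ker_eq_two {f : (Fin 3 → E) →ₗ[E] E} (hf : f ≠ 0) :
    Module.finrank E (LinearMap.ker f) = 2 := by
  have h := LinearMap.finrank_range_add_finrank_ker f
  rw [LinearMap.range_eq_top.2 (LinearMap.surjective hf), finrank_top, Module.finrank_self] at h
  simp at h
  omega

lemma isLine_actLine_ker (g : (Fin 3 → E) ≃ₗ[E] (Fin 3 → E)) {f : (Fin 3 → E) →ₗ[E] E}
    (hf : f ≠ 0) : IsLine (actLine g (LinearMap.ker f)) := by
  rw [IsLine, actLine, ← finrank_ker_eq_two hf]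
  exact LinearEquiv.finrank_map_eq g _

lemma apply_mem_actLine_ker {g : (Fin 3 → E) ≃ₗ[E] (Fin 3 → E)} {f : (Fin 3 → E) →ₗ[E] E}
    {X : Fin 3 → E} : g X ∈ actLine g (LinearMap.ker f) ↔ f X = 0 := by
  constructor
  · rintro ⟨Y, hY, h⟩
    rw [← g.injective h]
    exact hY
  · intro h
    exact ⟨X, h, rfl⟩

/-- The linear form whose coefficients are the conjugates of `c`. -/
def conjForm (F : Type*) {E : Type*} [Field F] [Fintype F] [Field E] [Algebra F E] (c : E) :
    (Fin 3 → E) →ₗ[E] E :=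
  Fintype.linearCombination E (conjugates F c)

lemma conjForm_apply (c : E) (X : Fin 3 → E) :
    conjForm F c X = c * X 0 + σ c * X 1 + σ (σ c) * X 2 := by
  rw [conjForm, Fintype.linearCombination_apply, Fin.sum_univ_three]
  simp only [conjugates, smul_eq_mul, Matrix.cons_val]
  ring

lemma conjForm_conjugates (hdeg : Module.finrank F E = 3) (c w : E) :
    conjForm F c (conjugates F w) = algebraMap F E (Algebra.trace F E (c * w)) := by
  rw [conjForm_apply, (isCubicGenerator_frobenius hdeg).trace, map_mul, map_mul]
  rfl

lemma conjForm_ne_zero {c : E} (hc : c ≠ 0) : conjForm F c ≠ 0 := by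
  intro h
  have := LinearMap.congr_fun h ![1, 0, 0]
  rw [conjForm_apply] at this
  simp [hc] at this

lemma exists_smul_eq_of_conjugates (hdeg : Module.finrank F E = 3) {w w' s : E} (hw : w ≠ 0)
    (h : s • conjugates F w = conjugates F w') : ∃ c : F, c • w = w' := by
  have h0 := congrFun h 0
  have h1 := congrFun h 1
  simp only [conjugates, Pi.smul_apply, smul_eq_mul, Matrix.cons_val] at h0 h1
  apply (isCubicGenerator_frobenius hdeg).exists_smul_eq hw
  rw [← h0] at h1 ⊢
  rw [← h1]; ring

lemma exists_independent_mem_traceOrthogonal (hdeg : Module.finrank F E = 3) {c w : E}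
    (hc : c ≠ 0) : ∃ w', Algebra.trace F E (c * w') = 0 ∧ ∀ x : F, x • w ≠ w' := by
  by_contra! hall
  have hle : traceOrthogonal F c ≤ F ∙ w := fun w' hw' =>
    Submodule.mem_span_singleton.2 (hall w' (mem_traceOrthogonal.1 hw'))
  have hfd : FiniteDimensional F E := FiniteDimensional.of_finrank_pos (by omega)
  have h1 := Submodule.finrank_mono hle
  have h2 := finrank_span_le_card (R := F) ({w} : Set E)
  rw [finrank_traceOrthogonal hdeg hc] at h1
  simp at h2
  omega

/-- The extended line of the subplane with dual coordinates `c`, in the frame `a`. -/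
def frameLine (F : Type*) {E : Type*} [Field F] [Fintype F] [Field E] [Algebra F E]
    (a : (Fin 3 → E) ≃ₗ[E] (Fin 3 → E)) (c : E) : Submodule E (Fin 3 → E) :=
  actLine a (LinearMap.ker (conjForm F c))

lemma conjugates_mem_frameLine (hdeg : Module.finrank F E = 3) {c w : E} :
    a (conjugates F w) ∈ frameLine F a c ↔ Algebra.trace F E (c * w) = 0 := by
  rw [frameLine, apply_mem_actLine_ker, conjForm_conjugates hdeg, map_eq_zero]

lemma mk_conjugates_ne (hdeg : Module.finrank F E = 3) {w w' : E} (hw : w ≠ 0)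
    (hw' : w' ≠ 0) (h : ∀ x : F, x • w ≠ w') :
    Projectivization.mk E _ (conjugates_frame_ne_zero (F := F) (a := a) hw) ≠
      Projectivization.mk E _ (conjugates_frame_ne_zero (F := F) (a := a) hw') := by
  intro heq
  obtain ⟨s, hs⟩ := (Projectivization.mk_eq_mk_iff' E _ _ _ _).1 heq.symm
  rw [← map_smul] at hs
  obtain ⟨x, hx⟩ := exists_smul_eq_of_conjugates hdeg hw (a.injective hs)
  exact h x hx

lemma IsFrame.isLineOf_frameLine (hdeg : Module.finrank F E = 3) (ha : IsFrame F a π) {c : E}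
    (hc : c ≠ 0) : IsLineOf π (frameLine F a c) := by
  -- Independence from the vector 0 just makes `w` nonzero.
  obtain ⟨w, hw, h0⟩ := exists_independent_mem_traceOrthogonal (F := F) hdeg (w := 0) hc
  obtain ⟨w', hw', h⟩ := exists_independent_mem_traceOrthogonal (F := F) hdeg (w := w) hc
  have hw0 := ne_zero_of_forall_smul_ne h0
  have hw0' := ne_zero_of_forall_smul_ne h
  exact ⟨isLine_actLine_ker a (conjForm_ne_zero hc), _, ha.mk_mem hw0 _, _, ha.mk_mem hw0' _,
    mk_conjugates_ne hdeg hw0 hw0' h, (mk_mem_pts _).2 ((conjugates_mem_frameLine hdeg).2 hw),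
    (mk_mem_pts _).2 ((conjugates_mem_frameLine hdeg).2 hw')⟩

lemma IsFrame.exists_eq_frameLine (hdeg : Module.finrank F E = 3) (ha : IsFrame F a π)
    {L : Submodule E (Fin 3 → E)} (hL : IsLineOf π L) : ∃ c ≠ 0, L = frameLine F a c := by
  obtain ⟨hL2, p, hp, r, hr, hne, hpL, hrL⟩ := hL
  rw [ha.eq] at hp hr
  obtain ⟨w, hw, hpw⟩ := hp
  obtain ⟨w', hw', hrw⟩ := hr
  have hwL : a (conjugates F w) ∈ L := by
    apply hpL
    rw [hpw]
    exact Submodule.mem_span_singleton_self _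
  have hwL' : a (conjugates F w') ∈ L := by
    apply hrL
    rw [hrw]
    exact Submodule.mem_span_singleton_self _
  have hfd : FiniteDimensional F E := FiniteDimensional.of_finrank_pos (by omega)
  -- Two trace conditions on the three-dimensional F-space E leave a nonzero solution.
  obtain ⟨c, hcker, hc⟩ := Submodule.exists_mem_ne_zero_of_ne_bot
    (LinearMap.ker_ne_bot_of_finrank_lt (f := (Algebra.trace F E ∘ₗ LinearMap.mulRight F w).prod
      (Algebra.trace F E ∘ₗ LinearMap.mulRight F w')) (by rw [hdeg]; simp))
  have hcw : Algebra.trace F E (c * w) = 0 := congrArg Prod.fst hcker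
  have hcw' : Algebra.trace F E (c * w') = 0 := congrArg Prod.snd hcker
  refine ⟨c, hc, Submodule.eq_of_le_of_finrank_eq ?_ ?_⟩
  · intro X hX
    obtain ⟨α, β, rfl⟩ := exists_smul_add_smul_eq hL2 hwL hwL' (conjugates_frame_ne_zero hw)
      (fun s hs => hne (Projectivization.submodule_injective (by
        have hs0 : s ≠ 0 := by
          rintro rfl
          rw [zero_smul] at hs
          exact conjugates_frame_ne_zero hw' hs.symm
        rw [hpw, hrw, ← hs, Submodule.span_singleton_smul_eq (IsUnit.mk0 s hs0)]))) hX
    exact Submodule.add_mem _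
      (Submodule.smul_mem _ _ ((conjugates_mem_frameLine hdeg).2 hcw))
      (Submodule.smul_mem _ _ ((conjugates_mem_frameLine hdeg).2 hcw'))
  · rw [show Module.finrank E L = 2 from hL2]
    exact (isLine_actLine_ker a (conjForm_ne_zero hc)).symm

lemma mem_lineAtInfinity_and_frameLine (ha : ∀ X, a X 2 = X 0) {c : E} (hc : c ≠ 0)
    {p : ℙ E (Fin 3 → E)} :
    (p ∈ pts (lineAtInfinity E) ∧ p ∈ pts (frameLine F a c)) ↔
      p.submodule = E ∙ a ![0, σ (σ c), -σ c] := by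
  have hσc : σ c ≠ 0 := by rwa [Ne, map_eq_zero]
  have hσσc : σ (σ c) ≠ 0 := by rwa [Ne, map_eq_zero]
  have hmem : a ![0, σ (σ c), -σ c] ∈ lineAtInfinity E ⊓ frameLine F a c := by
    constructor
    · change a _ 2 = 0
      rw [ha]; rfl
    · rw [frameLine]
      refine apply_mem_actLine_ker.2 ?_
      rw [conjForm_apply]
      simp only [Matrix.cons_val]
      ring
  constructor
  · induction p using Projectivization.ind with
    | h v hv =>
      rw [mk_mem_pts, mk_mem_pts, Projectivization.submodule_mk]
      obtain ⟨X, rfl⟩ := a.surjective v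
      rintro ⟨h1, h2⟩
      have hX0 : X 0 = 0 := by rw [← ha X]; exact h1
      rw [frameLine, apply_mem_actLine_ker, conjForm_apply, hX0] at h2
      have hX : X = (X 1 / σ (σ c)) • ![0, σ (σ c), -σ c] := by
        ext i
        fin_cases i
        · simpa using hX0
        · simp only [Fin.mk_one, Pi.smul_apply, Matrix.cons_val, smul_eq_mul]
          rw [div_mul_cancel₀ _ hσσc]
        · simp only [Fin.reduceFinMk, Pi.smul_apply, Matrix.cons_val, smul_eq_mul]
          rw [div_mul_eq_mul_div, eq_div_iff hσσc]
          linear_combination h2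
      have hs : X 1 / σ (σ c) ≠ 0 := by
        intro hs
        rw [hs, zero_smul] at hX
        exact hv (by rw [hX, map_zero])
      conv_lhs => rw [hX, map_smul]
      rw [Submodule.span_singleton_smul_eq (IsUnit.mk0 _ hs)]
  · intro hp
    have : p.submodule ≤ lineAtInfinity E ⊓ frameLine F a c := by
      rw [hp, Submodule.span_singleton_le_iff_mem]
      exact hmem
    exact ⟨this.trans inf_le_left, this.trans inf_le_right⟩

lemma exists_submodule_eq_span {v : Fin 3 → E} (hv : v ≠ 0) :
    ∃ p : ℙ E (Fin 3 → E), p.submodule = E ∙ v :=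
  ⟨Projectivization.mk E v hv, Projectivization.submodule_mk _ _⟩

/-- The spread elements of the points at infinity on a set of lines of the subplane. -/
lemma spreadSet_eq_ruledFamily (ha : ∀ X, a X 2 = X 0) {d : Set (ℙ E (Fin 3 → E))}
    {𝓛 : Set (Submodule E (Fin 3 → E))} {S : Set E} (hS : ∀ c ∈ S, c ≠ 0)
    (h𝓛 : 𝓛 = frameLine F a '' S)
    (hd : d = {p | p ∈ pts (lineAtInfinity E) ∧ ∃ L ∈ 𝓛, p ∈ pts L}) {ρ : E →ₐ[F] E} {u : E}
    {β : E → E} (hβ : β '' S = {b | b ≠ 0 ∧ Algebra.trace F E (u * b) = 0})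
    (hspan : ∀ c ∈ S, ∃ s : E, s ≠ 0 ∧ ![0, σ (σ c), -σ c] = s • ![0, β c, -ρ (β c)]) :
    spreadSet F d = ruledFamily (frameInfinity F a) ρ u := by
  have key : ∀ c ∈ S, ∀ p : ℙ E (Fin 3 → E), (p ∈ pts (lineAtInfinity E) ∧
      p ∈ pts (frameLine F a c)) ↔ p.submodule = E ∙ a ![0, β c, -ρ (β c)] := by
    intro c hc p
    obtain ⟨s, hs, h⟩ := hspan c hc
    rw [mem_lineAtInfinity_and_frameLine ha (hS c hc), h, map_smul,
      Submodule.span_singleton_smul_eq (IsUnit.mk0 _ hs)]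
  rw [ruledFamily, ← hβ, spreadSet, hd, h𝓛]
  ext P
  constructor
  · rintro ⟨p, ⟨hp, _, ⟨c, hc, rfl⟩, hpc⟩, rfl⟩
    exact ⟨β c, ⟨c, hc, rfl⟩, (ruledPlane_frameInfinity ((key c hc p).1 ⟨hp, hpc⟩)).symm⟩
  · rintro ⟨_, ⟨c, hc, rfl⟩, rfl⟩
    have hb0 : β c ≠ 0 := (hβ.subset ⟨c, hc, rfl⟩ : _ ∧ _).1
    have hne : a ![0, β c, -ρ (β c)] ≠ 0 := by
      rw [Ne, map_eq_zero_iff _ a.injective]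
      intro h
      exact hb0 (congrFun h 1)
    obtain ⟨p, hp⟩ := exists_submodule_eq_span hne
    obtain ⟨h1, h2⟩ := (key c hc p).2 hp
    exact ⟨p, ⟨h1, _, ⟨c, hc, rfl⟩, h2⟩, ruledPlane_frameInfinity hp⟩

lemma IsFrame.subset_exteriorSplash (hdeg : Module.finrank F E = 3) (ha : IsFrame F a π)
    {d : Set (ℙ E (Fin 3 → E))}
    {𝓛 : Set (Submodule E (Fin 3 → E))} {S : Set E} (hS : ∀ c ∈ S, c ≠ 0)
    (h𝓛 : 𝓛 = frameLine F a '' S)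
    (hd : d = {p | p ∈ pts (lineAtInfinity E) ∧ ∃ L ∈ 𝓛, p ∈ pts L}) : d ⊆ exteriorSplash π := by
  rw [hd, h𝓛]
  rintro p ⟨hp, _, ⟨c, hc, rfl⟩, hpc⟩
  exact ⟨hp, _, ha.isLineOf_frameLine hdeg (hS c hc), hpc⟩

/-! ### Pencil sublines -/

/-- The lines through the point of `w` are those with Tr(c w) = 0. With b = σ²c the point at
infinity is (0, b, -σ²b), because σ⁴ = σ, and the condition becomes Tr(σ²w · b) = 0. -/
theorem IsFrame.spreadSet_of_isPencilSubline (hdeg : Module.finrank F E = 3) (ha : IsFrame F a π)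
    {d : Set (ℙ E (Fin 3 → E))} (hd : IsPencilSubline π d) :
    d ⊆ exteriorSplash π ∧ ∃ u ≠ 0, spreadSet F d = ruledFamily (frameInfinity F a) (σ ^ 2) u := by
  have hσ := isCubicGenerator_frobenius (F := F) hdeg
  obtain ⟨A, hA, hd⟩ := hd
  rw [ha.eq] at hA
  obtain ⟨w, hw, hAw⟩ := hA
  have hAL : ∀ c, A ∈ pts (frameLine F a c) ↔ Algebra.trace F E (c * w) = 0 := by
    intro c
    rw [← conjugates_mem_frameLine hdeg (a := a), pts, Set.mem_ofPred_eq, hAw,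
      Submodule.span_singleton_le_iff_mem]
  have h𝓛 : {L | IsLineOf π L ∧ A ∈ pts L} =
      frameLine F a '' {c | c ≠ 0 ∧ Algebra.trace F E (c * w) = 0} := by
    ext L
    constructor
    · rintro ⟨hL, hAl⟩
      obtain ⟨c, hc, rfl⟩ := ha.exists_eq_frameLine hdeg hL
      exact ⟨c, ⟨hc, (hAL c).1 hAl⟩, rfl⟩
    · rintro ⟨c, ⟨hc, hcw⟩, rfl⟩
      exact ⟨ha.isLineOf_frameLine hdeg hc, (hAL c).2 hcw⟩
  have hd' : d = {p | p ∈ pts (lineAtInfinity E) ∧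
      ∃ L ∈ {L | IsLineOf π L ∧ A ∈ pts L}, p ∈ pts L} := by
    rw [hd]
    simp only [Set.mem_ofPred_eq, and_assoc]
  have htr : ∀ x, Algebra.trace F E (σ x) = Algebra.trace F E x := fun x => by
    apply (algebraMap F E).injective
    rw [hσ.trace, hσ.trace, hσ.cube]; ring
  refine ⟨ha.subset_exteriorSplash hdeg (fun c hc => hc.1) h𝓛 hd', σ (σ w), ?_,
    spreadSet_eq_ruledFamily ha.last (fun c hc => hc.1) h𝓛 hd' (β := fun c => σ (σ c)) ?_ ?_⟩
  · rwa [Ne, map_eq_zero, map_eq_zero]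
  · ext b
    constructor
    · rintro ⟨c, ⟨hc, hcw⟩, rfl⟩
      refine ⟨by rwa [Ne, map_eq_zero, map_eq_zero], ?_⟩
      rw [← map_mul, ← map_mul, htr, htr, mul_comm, hcw]
    · rintro ⟨hb, hbw⟩
      refine ⟨σ b, ⟨by rwa [Ne, map_eq_zero], ?_⟩, hσ.cube b⟩
      rw [← hσ.cube w, ← map_mul, htr, mul_comm, hbw]
  · intro c hc
    refine ⟨1, one_ne_zero, ?_⟩
    rw [one_smul, frobenius_sq_apply, hσ.cube]

/-! ### Special dual conics -/

/-- A homography fixing the subplane and the line at infinity carries the frame to another frame of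
the same subplane, so it is diagonal in these coordinates up to a scalar and fixes each coordinate
line. -/
lemma IsFrame.isFixedLine (hdeg : Module.finrank F E = 3) (ha : IsFrame F a π) (j : Fin 3) :
    IsFixedLine π (lineAtInfinity E)
      (actLine a (LinearMap.ker (LinearMap.proj j : (Fin 3 → E) →ₗ[E] E))) := by
  have hproj : (LinearMap.proj j : (Fin 3 → E) →ₗ[E] E) ≠ 0 := by
    intro h
    simpa using LinearMap.congr_fun h (fun _ => 1)
  refine ⟨isLine_actLine_ker a hproj, fun h hπ hℓ => ?_⟩
  have ha' := ha.transport hℓ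
  rw [hπ] at ha'
  obtain ⟨e, -, he⟩ := ha.exists_diagonal hdeg ha'
  have hs := (apply_two_of_fixes hℓ).1
  refine Submodule.eq_of_le_of_finrank_eq ?_ (LinearEquiv.finrank_map_eq h _)
  rintro _ ⟨_, ⟨X, hX, rfl⟩, rfl⟩
  have hX0 : X j = 0 := hX
  have := he X
  rw [transportFrame_apply, inv_smul_eq_iff₀ hs, ← map_smul] at this
  refine ⟨_, ?_, this.symm⟩
  change h ![0, 0, 1] 2 * _ = (0 : E)
  fin_cases j <;> simp_all

lemma lineWithCoords_eq_actLine {g : (Fin 3 → E) ≃ₗ[E] (Fin 3 → E)} {u : Fin 3 → E}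
    {f : (Fin 3 → E) →ₗ[E] E} (h : ∀ i, u i = f (a.symm (g (Pi.single i 1)))) :
    lineWithCoords g u = actLine a (LinearMap.ker f) := by
  have hf : (∑ i, u i • (LinearMap.proj i : (Fin 3 → E) →ₗ[E] E)) =
      f ∘ₗ (g.trans a.symm).toLinearMap := by
    refine LinearMap.pi_ext' fun i => LinearMap.ext_ring ?_
    simp [h, Pi.single_apply]
  rw [lineWithCoords, hf]
  ext X
  rw [← g.apply_symm_apply X, apply_mem_actLine_ker]
  conv_rhs => rw [g.apply_symm_apply, ← a.apply_symm_apply X, apply_mem_actLine_ker]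
  simp

/-- Two linear forms with the same kernel are proportional; here one of them is the `j`-th frame
coordinate. -/
lemma exists_smul_of_lineWithCoords_eq {g : (Fin 3 → E) ≃ₗ[E] (Fin 3 → E)} {u : Fin 3 → E}
    {j : Fin 3}
    (h : lineWithCoords g u =
      actLine a (LinearMap.ker (LinearMap.proj j : (Fin 3 → E) →ₗ[E] E))) :
    ∃ s : E, ∀ i, u i = s * a.symm (g (Pi.single i 1)) j := by
  let f : (Fin 3 → E) →ₗ[E] E :=
    (∑ i, u i • (LinearMap.proj i : (Fin 3 → E) →ₗ[E] E)) ∘ₗ (a.trans g.symm).toLinearMap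
  have hu : ∀ i, u i = f (a.symm (g (Pi.single i 1))) := fun i => by
    simp [f, Pi.single_apply]
  rw [lineWithCoords_eq_actLine hu] at h
  refine ⟨f (Pi.single j 1), fun i => ?_⟩
  rw [hu]
  set X := a.symm (g (Pi.single i 1))
  have hker : f (X - X j • Pi.single j 1) = 0 := by
    rw [← apply_mem_actLine_ker (g := a), h, apply_mem_actLine_ker]
    simp
  rw [map_sub, map_smul, sub_eq_zero] at hker
  rw [hker, smul_eq_mul, mul_comm]

lemma exists_trace_mul_eq (hdeg : Module.finrank F E = 3) (φ : (Fin 3 → F) ≃ₗ[F] E)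
    (u : Fin 3 → F) : ∃ c : E, ∀ i, Algebra.trace F E (c * φ (Pi.single i 1)) = u i := by
  have hfd : FiniteDimensional F E := FiniteDimensional.of_finrank_pos (by omega)
  let f : E →ₗ[F] (Fin 3 → F) :=
    LinearMap.pi fun i => Algebra.trace F E ∘ₗ LinearMap.mulRight F (φ (Pi.single i 1))
  have hinj : Function.Injective f := by
    rw [injective_iff_map_eq_zero]
    intro c hc
    by_contra hc0
    have hzero : (Algebra.trace F E ∘ₗ LinearMap.mulLeft F c) ∘ₗ φ.toLinearMap = 0 :=
      LinearMap.pi_ext' fun i => LinearMap.ext_ring (by simpa [f] using congrFun hc i)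
    obtain ⟨x, hx⟩ := Algebra.trace_surjective F E 1
    have := LinearMap.congr_fun hzero (φ.symm (x / c))
    simp [mul_div_cancel₀ _ hc0, hx] at this
  obtain ⟨c, hc⟩ := (LinearMap.injective_iff_surjective_of_finrank_eq_finrank
    (by simp [hdeg])).1 hinj u
  exact ⟨c, fun i => congrFun hc i⟩

/-- A line of the subplane has dual coordinates Tr(c φ(eᵢ)), that is, c N₀ + σc N₁ + σ²c N₂, where
`N j` are the dual coordinates of the line Xⱼ = 0. Since `Q` vanishes at each `N j`, only the mixed
products of conjugates of c survive, and rationality of the values makes their coefficients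
conjugate. -/
theorem exists_frame_of_isSpecialDualConic (hdeg : Module.finrank F E = 3)
    (hext : IsExteriorTo π (lineAtInfinity E)) {Γ : Set (Submodule E (Fin 3 → E))}
    (hΓ : IsSpecialDualConic F π (lineAtInfinity E) Γ) :
    ∃ (a : (Fin 3 → E) ≃ₗ[E] (Fin 3 → E)) (c₀ : E), IsFrame F a π ∧ c₀ ≠ 0 ∧
      Γ = frameLine F a '' {c | c ≠ 0 ∧ Algebra.trace F E (c₀ * (σ c * σ (σ c))) = 0} := by
  have hσ := isCubicGenerator_frobenius (F := F) hdeg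
  obtain ⟨g, Q, hg, hhom, hQ0, rfl, hfix⟩ := hΓ
  obtain ⟨a, φ, ha, hφ⟩ := exists_isFrame hdeg hg hext
  obtain ⟨q₀, q₁, q₂, q₃, q₄, q₅, hQ⟩ := exists_quadratic_coefficients hhom
  let N : Fin 3 → Fin 3 → E := fun j i => conjugates F (φ (Pi.single i 1)) j
  have hN : ∀ i, a.symm (g (Pi.single i 1)) = fun j => N j i := by
    intro i
    rw [LinearEquiv.symm_apply_eq]
    refine Eq.trans ?_ (hφ _).symm
    congr 1
    ext j
    simp [Pi.single_apply, apply_ite (algebraMap F E)]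
  let q : (Fin 3 → E) → E := fun u => algebraMap F E q₀ * u 0 ^ 2 + algebraMap F E q₁ * u 1 ^ 2 +
    algebraMap F E q₂ * u 2 ^ 2 + algebraMap F E q₃ * (u 0 * u 1) +
    algebraMap F E q₄ * (u 0 * u 2) + algebraMap F E q₅ * (u 1 * u 2)
  have hq : ∀ u, MvPolynomial.aeval u Q = q u := fun u => by
    rw [hQ]; simp [q]
  have heval : ∀ u : Fin 3 → F, algebraMap F E (MvPolynomial.eval u Q) =
      q fun i => algebraMap F E (u i) := fun u => by
    rw [hQ]; simp [q]
  have hqN : ∀ j, q (N j) = 0 := by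
    intro j
    obtain ⟨u, hu0, hu, huL⟩ := hfix _ (ha.isFixedLine hdeg j)
    obtain ⟨s, hs⟩ := exists_smul_of_lineWithCoords_eq huL.symm
    have hs' : ∀ i, u i = s * N j i := fun i => by rw [hs, hN]
    have hs0 : s ≠ 0 := by
      rintro rfl
      exact hu0 (funext fun i => by simp [hs'])
    rw [hq] at hu
    have : s ^ 2 * q (N j) = 0 := by
      rw [← hu]
      simp only [q, hs']
      ring
    exact (mul_eq_zero.1 this).resolve_left (pow_ne_zero 2 hs0)
  obtain ⟨p₃, p₄, p₅, hp⟩ : ∃ p₃ p₄ p₅ : E, ∀ c,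
      q (fun i => algebraMap F E (Algebra.trace F E (c * φ (Pi.single i 1)))) =
        p₃ * (c * σ c) + p₄ * (c * σ (σ c)) + p₅ * (σ c * σ (σ c)) := by
    -- These are the values of the polar form, as `q` vanishes at each `N j`.
    refine ⟨q (N 0 + N 1), q (N 0 + N 2), q (N 1 + N 2), fun c => ?_⟩
    have hu : ∀ i, algebraMap F E (Algebra.trace F E (c * φ (Pi.single i 1))) =
        c * N 0 i + σ c * N 1 i + σ (σ c) * N 2 i := fun i => by
      rw [← conjForm_conjugates hdeg, conjForm_apply]
    have h0 := hqN 0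
    have h1 := hqN 1
    have h2 := hqN 2
    simp only [q, hu, Pi.add_apply] at h0 h1 h2 ⊢
    linear_combination (c ^ 2 - c * σ c - c * σ (σ c)) * h0 +
      (σ c ^ 2 - c * σ c - σ c * σ (σ c)) * h1 +
      (σ (σ c) ^ 2 - c * σ (σ c) - σ c * σ (σ c)) * h2
  have hrat : ∀ c, σ (q fun i => algebraMap F E (Algebra.trace F E (c * φ (Pi.single i 1)))) =
      q fun i => algebraMap F E (Algebra.trace F E (c * φ (Pi.single i 1))) := fun c => by
    rw [← heval fun i => Algebra.trace F E (c * φ (Pi.single i 1)), AlgHom.commutes]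
  -- Values at F-rational coordinates are fixed by σ, which permutes the three mixed products
  -- cyclically.
  obtain ⟨-, -, -, h3, h4, h5⟩ := hσ.eq_zero_of_quadratic_eq_zero hdeg (p₀ := 0) (p₁ := 0)
    (p₂ := 0) (p₃ := p₃ - σ p₄) (p₄ := p₄ - σ p₅) (p₅ := p₅ - σ p₃) (fun c => by
      have := hrat c
      rw [hp] at this
      simp only [map_add, map_mul, hσ.cube] at this
      linear_combination -this)
  have hV : ∀ c, MvPolynomial.eval (fun i => Algebra.trace F E (c * φ (Pi.single i 1))) Q =
      Algebra.trace F E (p₅ * (σ c * σ (σ c))) := fun c => by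
    apply (algebraMap F E).injective
    rw [heval, hp, hσ.trace]
    have h4' : σ p₄ = σ (σ p₅) := by rw [sub_eq_zero.1 h4]
    simp only [map_mul, hσ.cube]
    linear_combination c * σ c * h3 + c * σ (σ c) * h4 + c * σ c * h4'
  refine ⟨a, p₅, ha, ?_, ?_⟩
  · rintro rfl
    have hall : ∀ u : Fin 3 → F, MvPolynomial.eval u Q = 0 := fun u => by
      obtain ⟨c, hc⟩ := exists_trace_mul_eq hdeg φ u
      rw [← funext hc, hV, zero_mul, map_zero]
    -- The values at the eᵢ and eᵢ + eⱼ determine all six coefficients, so a form vanishing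
    -- everywhere is the zero polynomial, even over the field with two elements.
    have e0 := hall ![1, 0, 0]
    have e1 := hall ![0, 1, 0]
    have e2 := hall ![0, 0, 1]
    have e3 := hall ![1, 1, 0]
    have e4 := hall ![1, 0, 1]
    have e5 := hall ![0, 1, 1]
    rw [hQ] at e0 e1 e2 e3 e4 e5
    simp at e0 e1 e2 e3 e4 e5
    simp only [e0, e1, e2, zero_add] at e3 e4 e5
    apply hQ0
    rw [hQ, e0, e1, e2, e3, e4, e5]
    simp
  · have hline : ∀ c, lineWithCoords g
        (fun i => algebraMap F E (Algebra.trace F E (c * φ (Pi.single i 1)))) =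
        frameLine F a c := fun c => by
      refine lineWithCoords_eq_actLine fun i => ?_
      rw [← conjForm_conjugates hdeg, hN]
    ext L
    constructor
    · rintro ⟨u, hu, hQu, rfl⟩
      obtain ⟨c, hc⟩ := exists_trace_mul_eq hdeg φ u
      obtain rfl : (fun i => Algebra.trace F E (c * φ (Pi.single i 1))) = u := funext hc
      refine ⟨c, ⟨?_, ?_⟩, (hline c).symm⟩
      · rintro rfl
        exact hu (funext fun i => by simp)
      · rw [← hV, hQu]
    · rintro ⟨c, ⟨hc, htr⟩, rfl⟩
      refine ⟨_, ?_, (hV c).trans htr, (hline c).symm⟩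
      intro h0
      have hzero : (Algebra.trace F E ∘ₗ LinearMap.mulLeft F c) ∘ₗ φ.toLinearMap = 0 :=
        LinearMap.pi_ext' fun i => LinearMap.ext_ring (by simpa using congrFun h0 i)
      have hfd : FiniteDimensional F E := FiniteDimensional.of_finrank_pos (by omega)
      obtain ⟨x, hx⟩ := Algebra.trace_surjective F E 1
      have := LinearMap.congr_fun hzero (φ.symm (x / c))
      simp [mul_div_cancel₀ _ hc, hx] at this

/-- Inversion linearises the conic: σc σ²c is N(c)/c with N(c) in F, so the equation becomes
Tr(c₀/c) = 0, which is linear in b = 1/σc. -/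
theorem exists_frame_of_isDualConicSubline (hdeg : Module.finrank F E = 3)
    (hext : IsExteriorTo π (lineAtInfinity E)) {d : Set (ℙ E (Fin 3 → E))}
    (hd : IsDualConicSubline F π d) :
    d ⊆ exteriorSplash π ∧ ∃ (a : (Fin 3 → E) ≃ₗ[E] (Fin 3 → E)) (u : E), IsFrame F a π ∧ u ≠ 0 ∧
      spreadSet F d = ruledFamily (frameInfinity F a) σ u := by
  have hσ := isCubicGenerator_frobenius (F := F) hdeg
  obtain ⟨Γ, hΓ, hd⟩ := hd
  obtain ⟨a, c₀, ha, hc₀, hΓ⟩ := exists_frame_of_isSpecialDualConic hdeg hext hΓ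
  have htr : ∀ c ≠ 0, (Algebra.trace F E (c₀ * (σ c * σ (σ c))) = 0 ↔
      Algebra.trace F E (σ c₀ * (σ c)⁻¹) = 0) := by
    intro c hc
    have hσc : σ c ≠ 0 := by rwa [Ne, map_eq_zero]
    have hσσc : σ (σ c) ≠ 0 := by rwa [Ne, map_eq_zero]
    obtain ⟨n, hn⟩ := hσ.fixed (c * σ c * σ (σ c)) (by
      simp only [map_mul, hσ.cube]; ring)
    have hn0 : n ≠ 0 := by
      rintro rfl
      rw [map_zero] at hn
      exact mul_ne_zero (mul_ne_zero hc hσc) hσσc hn.symm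
    have h1 : Algebra.trace F E (σ c₀ * (σ c)⁻¹) = Algebra.trace F E (c₀ * c⁻¹) := by
      apply (algebraMap F E).injective
      rw [hσ.trace, hσ.trace]
      simp only [map_mul, map_inv₀, hσ.cube]
      ring
    have h2 : c₀ * (σ c * σ (σ c)) = n • (c₀ * c⁻¹) := by
      rw [Algebra.smul_def, hn]
      field_simp
    rw [h1, h2, map_smul, smul_eq_mul, mul_eq_zero, or_iff_right hn0]
  refine ⟨ha.subset_exteriorSplash hdeg (fun c hc => hc.1) hΓ hd, a, σ c₀, ha, ?_,
    spreadSet_eq_ruledFamily ha.last (fun c hc => hc.1) hΓ hd (β := fun c => (σ c)⁻¹) ?_ ?_⟩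
  · rwa [Ne, map_eq_zero]
  · ext b
    constructor
    · rintro ⟨c, ⟨hc, h⟩, rfl⟩
      exact ⟨inv_ne_zero (by rwa [Ne, map_eq_zero]), (htr c hc).1 h⟩
    · rintro ⟨hb, h⟩
      have hc : σ (σ b⁻¹) ≠ 0 := by
        rw [Ne, map_eq_zero, map_eq_zero]
        exact inv_ne_zero hb
      refine ⟨σ (σ b⁻¹), ⟨hc, (htr _ hc).2 ?_⟩, ?_⟩
      · rwa [hσ.cube, inv_inv]
      · change (σ (σ (σ b⁻¹)))⁻¹ = b
        rw [hσ.cube, inv_inv]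
  · rintro c ⟨hc, -⟩
    have hσc : σ c ≠ 0 := by rwa [Ne, map_eq_zero]
    have hσσc : σ (σ c) ≠ 0 := by rwa [Ne, map_eq_zero]
    -- This factor takes (0, 1/σc, -1/σ²c) to (0, σ²c, -σc).
    refine ⟨σ c * σ (σ c), mul_ne_zero hσc hσσc, ?_⟩
    ext i
    fin_cases i
    · simp
    · simp only [Fin.mk_one, Pi.smul_apply, Matrix.cons_val, smul_eq_mul]
      field_simp
    · simp only [Fin.reduceFinMk, Pi.smul_apply, Matrix.cons_val, smul_eq_mul, map_inv₀]
      field_simp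

end Sublines

/-! ### The covers of an arbitrary exterior subplane -/

section Covers

variable {F E : Type*} [Field F] [Fintype F] [Field E] [Algebra F E]

local notation "σ" => FiniteField.frobeniusAlgHom F E

variable {τ : E} {π : Set (ℙ E (Fin 3 → E))}

lemma exists_isFrame_baseSubplane (hdeg : Module.finrank F E = 3) (hτ : σ τ ≠ τ) :
    ∃ a : (Fin 3 → E) ≃ₗ[E] (Fin 3 → E), IsFrame F a (baseSubplane F τ) ∧
      planeT F '' normOne F E = frameCover a (σ ^ 2) ∧
      planeC F '' normOne F E = frameCover a σ := by
  have hσ := isCubicGenerator_frobenius (F := F) hdeg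
  have h : τ - σ (σ τ) ≠ 0 := by
    intro h0
    have := hσ.cube τ
    rw [← sub_eq_zero.1 h0] at this
    exact hτ this
  have h' : σ τ - σ (σ τ) ≠ 0 := by
    intro h0
    exact hτ ((σ).toRingHom.injective (sub_eq_zero.1 h0)).symm
  exact ⟨_, isFrame_baseFrame hdeg hτ h h', image_planeT hdeg h h', image_planeC hdeg h h'⟩

/-- The homography from one frame to the other, `a` after the inverse of `a₀`, preserves the last
coordinate and matches conjugate vectors. -/
lemma IsFrame.exists_homography {a a₀ : (Fin 3 → E) ≃ₗ[E] (Fin 3 → E)}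
    {π₀ : Set (ℙ E (Fin 3 → E))} (ha₀ : IsFrame F a₀ π₀) (ha : IsFrame F a π) :
    ∃ g : (Fin 3 → E) ≃ₗ[E] (Fin 3 → E), actLine g (lineAtInfinity E) = lineAtInfinity E ∧
      actPoints g π₀ = π := by
  have hg2 : ∀ Y, (a₀.symm.trans a) Y 2 = Y 2 := fun Y => by
    rw [LinearEquiv.trans_apply, ha.last, ← ha₀.last (a₀.symm Y), LinearEquiv.apply_symm_apply]
  have hℓ : actLine (a₀.symm.trans a) (lineAtInfinity E) = lineAtInfinity E := by
    refine Submodule.eq_of_le_of_finrank_eq ?_ (LinearEquiv.finrank_map_eq _ _)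
    rintro _ ⟨Y, hY, rfl⟩
    exact (hg2 Y).trans hY
  refine ⟨_, hℓ, ?_⟩
  rw [(ha₀.transport hℓ).eq, ha.eq]
  have : ∀ X, transportFrame (a₀.symm.trans a) a₀ (apply_two_of_fixes hℓ).1 X = a X := fun X => by
    rw [transportFrame_apply, hg2]
    simp
  simp only [this]

lemma frobenius_sq_norm_eq (hdeg : Module.finrank F E = 3) (x : E) :
    x * (σ ^ 2) x * (σ ^ 2) ((σ ^ 2) x) = x * σ x * σ (σ x) := by
  simp only [frobenius_sq_apply, (isCubicGenerator_frobenius hdeg).cube]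
  ring

/-- A family of planes that is a frame cover of the base subplane is mapped to the frame cover of
the image. -/
lemma IsFrame.image_map_induced_eq (hdeg : Module.finrank F E = 3)
    {a a₀ g : (Fin 3 → E) ≃ₗ[E] (Fin 3 → E)} {π₀ : Set (ℙ E (Fin 3 → E))} (ha₀ : IsFrame F a₀ π₀)
    (ha : IsFrame F a π) (hℓ : actLine g (lineAtInfinity E) = lineAtInfinity E)
    (hπ : actPoints g π₀ = π) {ρ : E →ₐ[F] E} (hρ : IsCubicGenerator ρ)
    (hN : ∀ x, x * ρ x * ρ (ρ x) = x * σ x * σ (σ x)) {P : E → Submodule F (E × E × F)} {S : Set E}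
    (hP : P '' S = frameCover a₀ ρ) :
    (fun k => (P k).map (induced F g)) '' S = frameCover a ρ := by
  have ha' := ha₀.transport hℓ
  rw [hπ] at ha'
  rw [← ha.frameCover_eq hdeg ha' hρ hN, ← Set.image_image (fun W => W.map (induced F g)) P S, hP,
    frameCover, Set.image_image, frameCover]
  exact Set.image_congr fun k _ => map_induced_graphPlane ha₀.last _ ρ k

theorem IsFrame.isTangentCover_eq (hdeg : Module.finrank F E = 3) (hτ : σ τ ≠ τ)
    {a : (Fin 3 → E) ≃ₗ[E] (Fin 3 → E)} (ha : IsFrame F a π) {T : Set (Submodule F (E × E × F))}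
    (hT : IsTangentCover F τ π T) : T = frameCover a (σ ^ 2) := by
  obtain ⟨a₀, ha₀, hT₀, -⟩ := exists_isFrame_baseSubplane hdeg hτ
  obtain ⟨g, hℓ, hπ, rfl⟩ := hT
  exact ha₀.image_map_induced_eq hdeg ha hℓ hπ (isCubicGenerator_frobenius_sq hdeg)
    (frobenius_sq_norm_eq hdeg) hT₀

theorem IsFrame.isConicCover_eq (hdeg : Module.finrank F E = 3) (hτ : σ τ ≠ τ)
    {a : (Fin 3 → E) ≃ₗ[E] (Fin 3 → E)} (ha : IsFrame F a π) {C : Set (Submodule F (E × E × F))}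
    (hC : IsConicCover F τ π C) : C = frameCover a σ := by
  obtain ⟨a₀, ha₀, -, hC₀⟩ := exists_isFrame_baseSubplane hdeg hτ
  obtain ⟨g, hℓ, hπ, rfl⟩ := hC
  exact ha₀.image_map_induced_eq hdeg ha hℓ hπ (isCubicGenerator_frobenius hdeg)
    (fun _ => rfl) hC₀

end Covers

end BruckBose

end

theorem theorem6p1 {F E : Type*} [Field F] [Fintype F] [Field E] [Algebra F E]
    (hdeg : Module.finrank F E = 3)
    (τ : E) (hτ : ∀ x : E, x ≠ 0 → ∃ n : ℕ, τ ^ n = x)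
    (π : Set (Projectivization E (Fin 3 → E))) (hπ : BruckBose.IsSubplane F π)
    (hext : BruckBose.IsExteriorTo π (BruckBose.lineAtInfinity E)) :
    (∃ T, BruckBose.IsTangentCover F τ π T) ∧
    (∃ C, BruckBose.IsConicCover F τ π C) ∧
    ∀ T C : Set (Submodule F (E × E × F)),
      BruckBose.IsTangentCover F τ π T → BruckBose.IsConicCover F τ π C →
      (∀ d, BruckBose.IsPencilSubline π d →
        BruckBose.IsTwoRegulus (BruckBose.hyperplaneAtInfinity F E) (BruckBose.spreadSet F d) ∧
        BruckBose.spreadSet F d ⊆ BruckBose.spreadSet F (BruckBose.exteriorSplash π) ∧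
        BruckBose.MeetsInDistinctRulingLines (BruckBose.spreadSet F d) T ∧
        BruckBose.MeetsInConics (BruckBose.spreadSet F d) C) ∧
      (∀ d, BruckBose.IsDualConicSubline F π d →
        BruckBose.IsTwoRegulus (BruckBose.hyperplaneAtInfinity F E) (BruckBose.spreadSet F d) ∧
        BruckBose.spreadSet F d ⊆ BruckBose.spreadSet F (BruckBose.exteriorSplash π) ∧
        BruckBose.MeetsInConics (BruckBose.spreadSet F d) T ∧
        BruckBose.MeetsInDistinctRulingLines (BruckBose.spreadSet F d) C) := by
  have hfix := BruckBose.primitive_not_fixed (F := F) hdeg hτ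
  have hσ := BruckBose.isCubicGenerator_frobenius (F := F) hdeg
  have hσ2 := BruckBose.isCubicGenerator_frobenius_sq (F := F) hdeg
  obtain ⟨g, hg⟩ := hπ
  obtain ⟨a, -, ha, -⟩ := BruckBose.exists_isFrame hdeg hg hext
  obtain ⟨a₀, ha₀, -⟩ := BruckBose.exists_isFrame_baseSubplane hdeg hfix
  obtain ⟨h, hℓ, hhπ⟩ := ha₀.exists_homography ha
  refine ⟨⟨_, h, hℓ, hhπ, rfl⟩, ⟨_, h, hℓ, hhπ, rfl⟩,
    fun T C hT hC => ⟨fun d hd => ?_, fun d hd => ?_⟩⟩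
  · obtain ⟨hsub, u, hu, hd⟩ := ha.spreadSet_of_isPencilSubline hdeg hd
    have hJ := BruckBose.frameInfinity_injective (F := F) ha.last
    rw [ha.isTangentCover_eq hdeg hfix hT, ha.isConicCover_eq hdeg hfix hC,
      ← BruckBose.range_frameInfinity ha.last]
    refine ⟨?_, Set.image_mono hsub, ?_, ?_⟩ <;> rw [hd]
    · exact BruckBose.isTwoRegulus_ruledFamily hdeg hσ2 hJ hu
    · exact BruckBose.meetsInDistinctRulingLines_ruledFamily hdeg hσ2 hJ hu
    -- For ρ = σ² the other automorphism is ρ² = σ⁴ = σ, which belongs to the conic cover.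
    · have := BruckBose.meetsInConics_ruledFamily hdeg hσ2 (ρ' := FiniteField.frobeniusAlgHom F E)
        (fun x => by simp only [BruckBose.frobenius_sq_apply, hσ.cube]) hJ hu
      rw [BruckBose.frameCover]
      simpa only [BruckBose.frobenius_sq_norm_eq hdeg] using this
  -- The dual conic brings its own frame, which replaces the earlier one; the covers are the same in
  -- either.
  · obtain ⟨hsub, a, u, ha, hu, hd⟩ := BruckBose.exists_frame_of_isDualConicSubline hdeg hext hd
    have hJ := BruckBose.frameInfinity_injective (F := F) ha.last
    rw [ha.isTangentCover_eq hdeg hfix hT, ha.isConicCover_eq hdeg hfix hC,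
      ← BruckBose.range_frameInfinity ha.last]
    refine ⟨?_, Set.image_mono hsub, ?_, ?_⟩ <;> rw [hd]
    · exact BruckBose.isTwoRegulus_ruledFamily hdeg hσ hJ hu
    · have := BruckBose.meetsInConics_ruledFamily hdeg hσ BruckBose.frobenius_sq_apply hJ hu
      rw [BruckBose.frameCover]
      simpa only [BruckBose.frobenius_sq_norm_eq hdeg] using this
    · exact BruckBose.meetsInDistinctRulingLines_ruledFamily hdeg hσ hJ hu
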